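/- Fix constants $G,c>0$ and let $\Omega=\varphi\,dx$ be a matter distribution on $\mathbb R^3$: $\varphi\ge 0$ is smooth and compactly supported, with $m:=\int_{\mathbb R^3}\varphi\,dx>0$. For $\alpha\in[0,1]$, $a\in\{0,1\}$ and a matter distribution $\omega=\psi\,dx$ (with $\psi\ge0$ smooth and compactly supported), a solution of the generalized Poisson equation with source $\omega$ and boundary value $a$ means a positive function $\theta\in C^2(\mathbb R^3)$ with $$\theta^\alpha\,\Delta\theta=-4\pi\,\tfrac{G}{2c^2}\,\psi,\qquad \lim_{|x|\to\infty}\theta(x)=a .$$ **Theorem.** 1. For every $\alpha\in[0,1]$ the generalized Poisson equation with source $\Omega$ and boundary value $0$ has exactly one solution $\Theta_\alpha$. Put $m_{\mathrm{eff}}(\alpha):=\int_{\mathbb R^3}\varphi(y)\,\Theta_\alpha(y)^{-\alpha}\,dy$. 2. Let $\alpha\in[0,1]$, let $r_n>0$ with $r_n\to0$, put $d_n:=\left(\frac{G}{2c^2}\cdot\frac{m}{r_n}\right)^{-1}$, and let $(\omega_n)$ be a sequence of matter distributions that is self-similar of $\Omega$-type and interactivity $\alpha$, i.e. $\omega_n=d_n^{-\alpha}\,(\mathcal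 H_{d_n})_*\Omega$ for all $n$, where $\mathcal H_d(x)=d\,x$. Then for every $n$ the generalized Poisson equation with source $\omega_n$ and boundary value $1$ has exactly one solution $\theta_{\alpha,n}$, the functions $\theta_{\alpha,n}$ are smooth on $\mathbb R^3\setminus\{0\}$, and, as $n\to\infty$, they converge together with all their derivatives, uniformly on every compact subset of $\mathbb R^3\setminus\{0\}$, to $$\theta_{\mathrm{Schw},\alpha}(z)=1+\frac{G}{2c^2}\cdot\frac{m_{\mathrm{eff}}(\alpha)}{|z|}.$$ 3. The function $\alpha\mapsto m_{\mathrm{eff}}(\alpha)$ is continuous on $[0,1]$. -/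

import Mathlib

open MeasureTheory Filter Topology Set

/-- Euclidean three-space. -/
abbrev E3 : Type := EuclideanSpace ℝ (Fin 3)

/-- A matter distribution `φ dvol` on Euclidean three-space: the density `φ` is smooth,
nonnegative and compactly supported. -/
structure MatterDistribution where
  /-- the density with respect to the Euclidean volume -/
  density : E3 → ℝ
  smooth : ContDiff ℝ (⊤ : ℕ∞) density
  nonneg : ∀ x, 0 ≤ density x
  hasCompactSupport : HasCompactSupport density

namespace MatterDistribution

/-- The measure `φ dvol`. -/
noncomputable def toMeasure (ω : MatterDistribution) : Measure E3 :=
  volume.withDensity (fun x => ENNReal.ofReal (ω.density x))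

/-- The total (bare) mass `∫ φ dvol`. -/
noncomputable def mass (ω : MatterDistribution) : ℝ := ∫ x, ω.density x

end MatterDistribution

/-- The coupling constant `G / (2 c ^ 2)`. -/
noncomputable def coupling (G c : ℝ) : ℝ := G / (2 * c ^ 2)

/-- `θ` is a (classical, positive) solution of the generalized Poisson equation
`θ ^ α * Δ θ = - 4 π (G / 2 c ^ 2) φ` with source `ω = φ dvol` and boundary value `a` at infinity.
Positivity is what gives the real power `θ ^ α` its meaning. -/
structure IsPotential (G c α a : ℝ) (ω : MatterDistribution) (θ : E3 → ℝ) : Prop where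
  contDiff : ContDiff ℝ 2 θ
  pos : ∀ x, 0 < θ x
  equation : ∀ x, θ x ^ α * Laplacian.laplacian θ x
    = -(4 * Real.pi * coupling G c * ω.density x)
  boundary : Tendsto θ (cocompact E3) (𝓝 a)

/-- The solution of the generalized Poisson equation with parameter `α`, source `ω` and boundary
value `a` (an arbitrary function if there is no solution). -/
noncomputable def potential (G c α a : ℝ) (ω : MatterDistribution) : E3 → ℝ :=
  Classical.epsilon (IsPotential G c α a ω)

/-- The scale `d = ((G / 2 c ^ 2) * (m / r))⁻¹` that belongs to the radius `r`, where `m` is the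
mass of `Ω`. -/
noncomputable def dilationScale (G c : ℝ) (Ω : MatterDistribution) (r : ℝ) : ℝ :=
  (coupling G c * (Ω.mass / r))⁻¹

/-- The sequence `ω n` is self-similar of `Ω`-type and interactivity `α`, with radii `r n` shrinking
to zero: `ω n = (d n) ^ (-α) • (H n)_* Ω`, where `H n : x ↦ d n • x`. -/
structure IsSelfSimilar (G c α : ℝ) (Ω : MatterDistribution) (r : ℕ → ℝ)
    (ω : ℕ → MatterDistribution) : Prop where
  radius_pos : ∀ n, 0 < r n
  radius_tendsto : Tendsto r atTop (𝓝 0)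
  scaling : ∀ n, (ω n).toMeasure =
    ENNReal.ofReal (dilationScale G c Ω (r n) ^ (-α)) •
      Measure.map (fun x : E3 => dilationScale G c Ω (r n) • x) Ω.toMeasure

/-- The effective mass `∫ Ω / Θ ^ α`, where `Θ` is the solution of the generalized Poisson equation
with source `Ω` and boundary value `0`. -/
noncomputable def effectiveMass (G c : ℝ) (Ω : MatterDistribution) (α : ℝ) : ℝ :=
  ∫ y, Ω.density y / potential G c α 0 Ω y ^ α

/-- The point-source potential `1 + (G / 2 c ^ 2) M / |z|` of the mass `M`. -/
noncomputable def pointPotential (G c M : ℝ) (z : E3) : ℝ :=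
  1 + coupling G c * M / ‖z‖

/-- The functions `f n` and `g` are smooth on the open set `U`, and `f n` converges to `g` with all
derivatives, uniformly on all compact subsets of `U`. -/
def ConvergesWithAllDerivatives (U : Set E3) (f : ℕ → E3 → ℝ) (g : E3 → ℝ) : Prop :=
  (∀ n, ContDiffOn ℝ (⊤ : ℕ∞) (f n) U) ∧ ContDiffOn ℝ (⊤ : ℕ∞) g U ∧
    ∀ K : Set E3, IsCompact K → K ⊆ U → ∀ k : ℕ,
      TendstoUniformlyOn (fun n => iteratedFDeriv ℝ k (f n)) (iteratedFDeriv ℝ k g) atTop K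

/-! Write `κ = G / (2c²)` and `N f` for the Newton potential of `f`. Since `Δ (N f) = -4π f` and `N
f` vanishes at infinity, the maximum principle turns the boundary value problem into the integral
equation `θ = a + κ N(φ θ^(-α))` (`isPotential_iff`).

The nonlinearity `t ↦ t^(-α)` is decreasing, so the maximum principle also compares solutions
(`IsIntegralSolution.le_add`). This yields uniqueness and, with bounds on `θ` over the support of
`φ` that are uniform in `α` and in bounded `a`, a Lipschitz dependence on `a` and `α`. Existence for
`a > 0`, `α < 1` is a contraction argument for `log θ`, whose constant is `α`; the remaining cases
are limits of these by the Lipschitz estimate. Continuity of the effective mass follows from the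
same estimate and dominated convergence.

For the self-similar sequence, `η_n(x) = d_n θ_n(d_n x)` solves the equation with the fixed source
`Ω` and boundary value `d_n`, and comparison gives `Θ ≤ η_n ≤ Θ + d_n`. Hence the masses of the
sources `φ_n θ_n^(-α)` tend to the effective mass, while their supports shrink to the origin. Away
from the origin their Newton potentials are convolutions with a smooth function, and all derivatives
converge as for an approximate identity. -/

/-! ### The Newton kernel and its softening. -/

/-- The softened Newton kernel `(|x|² + δ) ^ (-1/2)`; the case `δ = 0` is the Newton kernel. -/
noncomputable def softKernel (δ : ℝ) (x : E3) : ℝ := (‖x‖ ^ 2 + δ) ^ (-(1 / 2) : ℝ)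

/-- The derivative of the softened Newton kernel. -/
noncomputable def softGrad (δ : ℝ) (x : E3) : E3 →L[ℝ] ℝ :=
  (-(‖x‖ ^ 2 + δ) ^ (-(3 / 2) : ℝ)) • innerSL ℝ x

/-- The Newton potential `x ↦ ∫ f y / |x - y| dy`. -/
noncomputable def newton {F : Type} [NormedAddCommGroup F] [NormedSpace ℝ F] (f : E3 → F) :
    E3 → F :=
  convolution (softKernel 0) f (ContinuousLinearMap.lsmul ℝ ℝ) volume

theorem softKernel_zero (x : E3) : softKernel 0 x = ‖x‖⁻¹ := by
  rw [softKernel, add_zero, ← Real.rpow_natCast, ← Real.rpow_mul (norm_nonneg _)]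
  norm_num [Real.rpow_neg_one]

theorem softKernel_nonneg {δ : ℝ} (hδ : 0 ≤ δ) (x : E3) : 0 ≤ softKernel δ x := by
  unfold softKernel; positivity

/-- The origin is excluded because `softKernel 0 0` is `0` by the conventions of real powers. -/
theorem softKernel_le {δ : ℝ} (hδ : 0 ≤ δ) {x : E3} (hx : x ≠ 0) :
    softKernel δ x ≤ softKernel 0 x := by
  unfold softKernel
  have : 0 < ‖x‖ := norm_pos_iff.2 hx
  exact Real.rpow_le_rpow_of_nonpos (by positivity) (by linarith) (by norm_num)

theorem norm_softGrad_le_inv {δ : ℝ} (hδ : 0 ≤ δ) {x : E3} (h : 0 < ‖x‖ ^ 2 + δ) :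
    ‖softGrad δ x‖ ≤ (‖x‖ ^ 2 + δ)⁻¹ := by
  have h1 : ‖x‖ ≤ (‖x‖ ^ 2 + δ) ^ (1 / 2 : ℝ) := by
    rw [← Real.sqrt_eq_rpow]
    exact Real.le_sqrt_of_sq_le (by linarith)
  rw [softGrad, norm_smul, norm_neg, innerSL_apply_norm, Real.norm_of_nonneg (by positivity)]
  calc (‖x‖ ^ 2 + δ) ^ (-(3 / 2) : ℝ) * ‖x‖
      ≤ (‖x‖ ^ 2 + δ) ^ (-(3 / 2) : ℝ) * (‖x‖ ^ 2 + δ) ^ (1 / 2 : ℝ) := by gcongr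
    _ = (‖x‖ ^ 2 + δ)⁻¹ := by
      rw [← Real.rpow_add h, ← Real.rpow_neg_one]; norm_num

/-- The bound is independent of `δ` and locally integrable in dimension three, so it dominates the
limit `δ → 0`. -/
theorem norm_softGrad_le {δ : ℝ} (hδ : 0 ≤ δ) (x : E3) :
    ‖softGrad δ x‖ ≤ 1 * ‖x‖ ^ (-2 : ℝ) := by
  rcases eq_or_ne x 0 with rfl | hx
  · simp [softGrad]
  have hx : 0 < ‖x‖ := norm_pos_iff.2 hx
  refine (norm_softGrad_le_inv hδ (by positivity)).trans ?_
  rw [one_mul, Real.rpow_neg hx.le, Real.rpow_two]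
  gcongr
  linarith

theorem measurable_softKernel (δ : ℝ) : Measurable (softKernel δ) := by
  unfold softKernel; fun_prop

theorem aestronglyMeasurable_softGrad (δ : ℝ) : AEStronglyMeasurable (softGrad δ) := by
  have h1 : Measurable fun x : E3 => -(‖x‖ ^ 2 + δ) ^ (-(3 / 2) : ℝ) := by fun_prop
  have h2 : Continuous fun x : E3 => innerSL ℝ x := (innerSL ℝ).continuous
  exact h1.aestronglyMeasurable.smul h2.aestronglyMeasurable

theorem locallyIntegrable_newtonKernel : LocallyIntegrable (softKernel 0) := by
  refine locallyIntegrable_of_norm_le_rpow (C := 1) (α := 1) (by simp) (by simp) ?_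
    (measurable_softKernel 0).aestronglyMeasurable
  refine .of_forall fun x => ?_
  rw [Real.norm_of_nonneg (softKernel_nonneg le_rfl x), softKernel_zero, Real.rpow_neg_one,
    one_mul]

theorem locallyIntegrable_softKernel {δ : ℝ} (hδ : 0 ≤ δ) :
    LocallyIntegrable (softKernel δ) := by
  refine locallyIntegrable_newtonKernel.mono (measurable_softKernel δ).aestronglyMeasurable ?_
  filter_upwards [compl_mem_ae_iff.2 (measure_singleton (0 : E3))] with x hx
  rw [Real.norm_of_nonneg (softKernel_nonneg le_rfl x),
    Real.norm_of_nonneg (softKernel_nonneg hδ x)]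
  exact softKernel_le hδ hx

theorem locallyIntegrable_softGrad {δ : ℝ} (hδ : 0 ≤ δ) : LocallyIntegrable (softGrad δ) :=
  locallyIntegrable_of_norm_le_rpow (C := 1) (α := 2) (by simp) (by norm_num)
    (.of_forall (norm_softGrad_le hδ)) (aestronglyMeasurable_softGrad δ)

theorem hasFDerivAt_softKernel {δ : ℝ} {x : E3} (h : 0 < ‖x‖ ^ 2 + δ) :
    HasFDerivAt (softKernel δ) (softGrad δ x) x := by
  have h1 : HasFDerivAt (fun x : E3 => ‖x‖ ^ 2 + δ) ((2 : ℝ) • innerSL ℝ x) x := by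
    have := (hasStrictFDerivAt_norm_sq x).hasFDerivAt.add_const δ
    simpa [two_smul] using this
  have h2 := h1.rpow_const (p := (-(1 / 2) : ℝ)) (Or.inl h.ne')
  convert! h2 using 1
  rw [softGrad, smul_smul]
  congr 1
  norm_num
  ring

theorem tendsto_softKernel {x : E3} (hx : x ≠ 0) :
    Tendsto (fun δ => softKernel δ x) (𝓝 0) (𝓝 (softKernel 0 x)) := by
  have hx : 0 < ‖x‖ := norm_pos_iff.2 hx
  have : ContinuousAt (fun δ : ℝ => (‖x‖ ^ 2 + δ) ^ (-(1 / 2) : ℝ)) 0 := by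
    refine ContinuousAt.rpow_const (by fun_prop) (Or.inl ?_)
    positivity
  exact this

theorem tendsto_softGrad {x : E3} (hx : x ≠ 0) :
    Tendsto (fun δ => softGrad δ x) (𝓝 0) (𝓝 (softGrad 0 x)) := by
  have hx : 0 < ‖x‖ := norm_pos_iff.2 hx
  have : ContinuousAt (fun δ : ℝ => (‖x‖ ^ 2 + δ) ^ (-(3 / 2) : ℝ)) 0 := by
    refine ContinuousAt.rpow_const (by fun_prop) (Or.inl ?_)
    positivity
  have h : Tendsto (fun δ : ℝ => (‖x‖ ^ 2 + δ) ^ (-(3 / 2) : ℝ)) (𝓝 0) _ := this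
  exact h.neg.smul_const _

/-! ### Newton potentials gain one derivative. -/

section Gain

variable {F : Type} [NormedAddCommGroup F] [NormedSpace ℝ F]

/-- The convolution with the derivative of the softened kernel. -/
noncomputable def gradConv (δ : ℝ) (f : E3 → F) : E3 → E3 →L[ℝ] F :=
  convolution (softGrad δ) f (ContinuousLinearMap.smulRightL ℝ E3 F) volume

/-- For `δ > 0` the gradient of the kernel is bounded by `δ⁻¹`, so differentiation under the
integral needs only continuity of `f`. -/
theorem hasFDerivAt_softConv {δ : ℝ} (hδ : 0 < δ) {f : E3 → F} (hf : Continuous f)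
    (hs : HasCompactSupport f) (x : E3) :
    HasFDerivAt (convolution (softKernel δ) f (ContinuousLinearMap.lsmul ℝ ℝ) volume)
      (gradConv δ f x) x := by
  have e1 : convolution (softKernel δ) f (ContinuousLinearMap.lsmul ℝ ℝ) volume =
      fun x => ∫ t, softKernel δ (x - t) • f t := by
    ext x; exact convolution_lsmul_swap
  have e2 : gradConv δ f x = ∫ t, (softGrad δ (x - t)).smulRight (f t) := by
    rw [gradConv, convolution_eq_swap]; rfl
  have hk : Continuous (softKernel δ) :=
    continuous_iff_continuousAt.2 fun x => (hasFDerivAt_softKernel (by positivity)).continuousAt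
  rw [e1, e2]
  refine hasFDerivAt_integral_of_dominated_of_fderiv_le (𝕜 := ℝ) (s := univ)
    (F := fun x t => softKernel δ (x - t) • f t)
    (F' := fun x t => (softGrad δ (x - t)).smulRight (f t))
    (bound := fun t => δ⁻¹ * ‖f t‖) univ_mem ?_ ?_ ?_ ?_ ?_ ?_
  · refine .of_forall fun y => ?_
    exact ((hk.comp (continuous_const.sub continuous_id)).smul hf).aestronglyMeasurable
  · exact ((hk.comp (continuous_const.sub continuous_id)).smul hf).integrable_of_hasCompactSupport
      (HasCompactSupport.smul_left (f := fun t => softKernel δ (x - t)) hs)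
  · exact AEStronglyMeasurable.convolution_integrand_swap_snd (μ := volume)
      (L := ContinuousLinearMap.smulRightL ℝ E3 F) (aestronglyMeasurable_softGrad δ)
      hf.aestronglyMeasurable x
  · refine .of_forall fun t y _ => ?_
    rw [ContinuousLinearMap.norm_smulRight_apply]
    gcongr
    refine (norm_softGrad_le_inv hδ.le (by positivity)).trans ?_
    gcongr
    nlinarith [sq_nonneg ‖y - t‖]
  · exact (Continuous.integrable_of_hasCompactSupport hf.norm hs.norm).const_mul _
  · refine .of_forall fun t y _ => ?_
    have h1 : HasFDerivAt (fun y => softKernel δ (y - t)) (softGrad δ (y - t)) y :=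
      by
        have h0 := hasFDerivAt_softKernel (δ := δ) (x := y - t) (by positivity)
        simpa using! h0.comp y ((hasFDerivAt_id y).sub_const t)
    exact h1.smul_const (f t)

theorem convolutionExists_softGrad {δ : ℝ} (hδ : 0 ≤ δ) {f : E3 → F} (hf : Continuous f)
    (hs : HasCompactSupport f) : ConvolutionExists (softGrad δ) f
      (ContinuousLinearMap.smulRightL ℝ E3 F) volume :=
  hs.convolutionExists_right _ (locallyIntegrable_softGrad hδ) hf

theorem continuous_gradConv {δ : ℝ} (hδ : 0 ≤ δ) {f : E3 → F} (hf : Continuous f)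
    (hs : HasCompactSupport f) : Continuous (gradConv δ f) :=
  hs.continuous_convolution_right _ (locallyIntegrable_softGrad hδ) hf

theorem continuous_newton {f : E3 → F} (hf : Continuous f)
    (hs : HasCompactSupport f) : Continuous (newton f) :=
  hs.continuous_convolution_right _ locallyIntegrable_newtonKernel hf

/-- The convolutions with the softened gradients converge uniformly on balls. -/
theorem tendstoUniformlyOn_gradConv {f : E3 → F} (hf : Continuous f)
    (hs : HasCompactSupport f) (R : ℝ) :
    TendstoUniformlyOn (fun n : ℕ => gradConv (1 / ((n : ℝ) + 1)) f) (gradConv 0 f) atTop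
      (Metric.ball 0 R) := by
  obtain ⟨S, hS⟩ := hs.isCompact.isBounded.subset_closedBall (0 : E3)
  obtain ⟨C, hC⟩ := hs.exists_bound_of_continuous hf
  have hC0 : 0 ≤ C := (norm_nonneg _).trans (hC 0)
  set B : Set E3 := Metric.closedBall 0 (R + S) with hB
  have hint : ∀ n : ℕ, IntegrableOn (fun t => ‖softGrad 0 t - softGrad (1 / ((n : ℝ) + 1)) t‖) B :=
    fun n => (((locallyIntegrable_softGrad le_rfl).sub (locallyIntegrable_softGrad
      (by positivity))).integrableOn_isCompact (isCompact_closedBall _ _)).norm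
  have hlim : Tendsto (fun n : ℕ => ∫ t in B, ‖softGrad 0 t - softGrad (1 / ((n : ℝ) + 1)) t‖)
      atTop (𝓝 0) := by
    have : Tendsto (fun n : ℕ => ∫ t in B, ‖softGrad 0 t - softGrad (1 / ((n : ℝ) + 1)) t‖)
      atTop (𝓝 (∫ t in B, (0 : ℝ))) := by
      refine tendsto_integral_of_dominated_convergence
        (fun t => 2 * ‖t‖ ^ (-2 : ℝ)) (fun n => (hint n).aestronglyMeasurable) ?_ ?_ ?_
      · have : LocallyIntegrable (fun t : E3 => ‖t‖ ^ (-2 : ℝ)) := by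
          refine locallyIntegrable_of_norm_le_rpow (C := 1) (α := 2) (by simp) (by norm_num) ?_ ?_
          · refine .of_forall fun x => ?_
            rw [Real.norm_of_nonneg (by positivity), one_mul]
          · exact (by fun_prop : Measurable fun t : E3 => ‖t‖ ^ (-2 : ℝ)).aestronglyMeasurable
        exact (this.integrableOn_isCompact (isCompact_closedBall _ _)).const_mul _
      · refine fun n => .of_forall fun t => ?_
        rw [norm_norm]
        refine (norm_sub_le _ _).trans ?_
        have h1 := norm_softGrad_le le_rfl t
        have h2 := norm_softGrad_le (δ := 1 / ((n : ℝ) + 1)) (by positivity) t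
        linarith
      · refine ae_restrict_of_ae ?_
        filter_upwards [compl_mem_ae_iff.2 (measure_singleton (0 : E3))] with t ht
        have := (tendsto_softGrad (x := t) ht).comp tendsto_one_div_add_atTop_nhds_zero_nat
        simpa using (this.const_sub (softGrad 0 t)).norm
    simpa using this
  rw [Metric.tendstoUniformlyOn_iff]
  intro ε hε
  have hlim' : Tendsto (fun n : ℕ => C *
      ∫ t in B, ‖softGrad 0 t - softGrad (1 / ((n : ℝ) + 1)) t‖) atTop (𝓝 0) := by
    simpa using hlim.const_mul C
  filter_upwards [hlim'.eventually_lt_const hε] with n hn x hx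
  refine lt_of_le_of_lt ?_ hn
  set δ : ℝ := 1 / ((n : ℝ) + 1) with hδ
  have hδ0 : 0 ≤ δ := by positivity
  have c1 := convolutionExists_softGrad (δ := 0) le_rfl hf hs x
  have c2 := convolutionExists_softGrad hδ0 hf hs x
  rw [dist_eq_norm, gradConv, gradConv, convolution_def, convolution_def,
    ← integral_sub c1.integrable c2.integrable]
  -- For `‖x‖ < R` only `t` in `B` contributes, so the difference is at most `C` times the `L¹`
  -- distance of the two kernels on `B`, uniformly in `x`.
  have hz : ∀ t ∉ B, f (x - t) = 0 := by
    intro t ht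
    by_contra hne
    apply ht
    have h1 : x - t ∈ Metric.closedBall (0 : E3) S := hS (subset_tsupport _ hne)
    rw [mem_closedBall_zero_iff] at h1 ⊢
    rw [mem_ball_zero_iff] at hx
    calc ‖t‖ = ‖x - (x - t)‖ := by simp
      _ ≤ ‖x‖ + ‖x - t‖ := norm_sub_le _ _
      _ ≤ R + S := by linarith
  rw [← setIntegral_eq_integral_of_forall_compl_eq_zero (s := B)]
  · rw [← integral_const_mul]
    refine norm_integral_le_of_norm_le ((hint n).const_mul C) (.of_forall fun t => ?_)
    have : (ContinuousLinearMap.smulRightL ℝ E3 F) (softGrad 0 t) (f (x - t)) -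
        (ContinuousLinearMap.smulRightL ℝ E3 F) (softGrad δ t) (f (x - t)) =
        (softGrad 0 t - softGrad δ t).smulRight (f (x - t)) := by
      ext v; simp [sub_smul]
    rw [this, ContinuousLinearMap.norm_smulRight_apply, mul_comm]
    gcongr
    exact hC _
  · intro t ht
    simp [hz t ht]

/-- The softened potentials converge pointwise and their derivatives converge locally uniformly. The
derivative lands on the kernel, so `f` need not be differentiable. -/
theorem hasFDerivAt_newton {f : E3 → F} (hf : Continuous f)
    (hs : HasCompactSupport f) (x : E3) :
    HasFDerivAt (newton f) (gradConv 0 f x) x := by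
  refine hasFDerivAt_of_tendstoUniformlyOn (s := Metric.ball 0 (‖x‖ + 1)) (l := atTop)
    (f := fun n : ℕ => convolution (softKernel (1 / ((n : ℝ) + 1))) f
      (ContinuousLinearMap.lsmul ℝ ℝ) volume) Metric.isOpen_ball
    (tendstoUniformlyOn_gradConv hf hs _)
    (fun n y _ => hasFDerivAt_softConv (by positivity) hf hs y) (fun y _ => ?_) (by simp)
  have c1 := (hs.convolutionExists_right (ContinuousLinearMap.lsmul ℝ ℝ)
    locallyIntegrable_newtonKernel hf y).integrable
  refine tendsto_integral_of_dominated_convergence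
    (fun t => ‖(ContinuousLinearMap.lsmul ℝ ℝ) (softKernel 0 t) (f (y - t))‖) (fun n => ?_)
    c1.norm (fun n => ?_) ?_
  · exact (hs.convolutionExists_right (ContinuousLinearMap.lsmul ℝ ℝ)
      (locallyIntegrable_softKernel (by positivity)) hf y).integrable.aestronglyMeasurable
  · filter_upwards [compl_mem_ae_iff.2 (measure_singleton (0 : E3))] with t ht
    simp only [ContinuousLinearMap.lsmul_apply, norm_smul]
    rw [Real.norm_of_nonneg (softKernel_nonneg le_rfl t),
      Real.norm_of_nonneg (softKernel_nonneg (by positivity) t)]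
    gcongr
    exact softKernel_le (by positivity) ht
  · filter_upwards [compl_mem_ae_iff.2 (measure_singleton (0 : E3))] with t ht
    have := (tendsto_softKernel (x := t) ht).comp tendsto_one_div_add_atTop_nhds_zero_nat
    exact this.smul_const _

theorem fderiv_newton {f : E3 → F} (hf : ContDiff ℝ 1 f)
    (hs : HasCompactSupport f) : fderiv ℝ (newton f) = newton (fderiv ℝ f) := by
  ext1 x
  rw [newton, (hs.hasFDerivAt_convolution_right (ContinuousLinearMap.lsmul ℝ ℝ)
    locallyIntegrable_newtonKernel hf x).fderiv]
  rw [newton, convolution_def, convolution_def]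
  congr

/-- The Newton potential gains one derivative. -/
theorem contDiff_newton (k : ℕ) : ∀ {F : Type} [NormedAddCommGroup F] [NormedSpace ℝ F]
    {f : E3 → F}, ContDiff ℝ k f → HasCompactSupport f → ContDiff ℝ (k + 1 : ℕ) (newton f) := by
  -- The inductive step replaces `f` by `fderiv ℝ f`; this is why the target space `F` varies.
  induction k with
  | zero =>
    intro F _ _ f hf hs
    have hf := hf.continuous
    have hd : fderiv ℝ (newton f) = gradConv 0 f := by
      ext1 x; exact (hasFDerivAt_newton hf hs x).fderiv
    rw [zero_add, Nat.cast_one, contDiff_one_iff_fderiv, hd]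
    exact ⟨fun x => (hasFDerivAt_newton hf hs x).differentiableAt,
      continuous_gradConv le_rfl hf hs⟩
  | succ k ih =>
    intro F _ _ f hf hs
    have h1 : ContDiff ℝ 1 f := hf.of_le (by exact_mod_cast Nat.succ_le_succ (Nat.zero_le k))
    rw [Nat.cast_add, Nat.cast_one, contDiff_succ_iff_fderiv, fderiv_newton h1 hs]
    refine ⟨fun x => (hasFDerivAt_newton h1.continuous hs x).differentiableAt, by simp,
      ih ?_ (hs.fderiv ℝ)⟩
    rw [Nat.cast_add, Nat.cast_one] at hf
    exact (contDiff_succ_iff_fderiv.1 hf).2.2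

end Gain

/-! ### The Laplacian of the Newton potential. -/

theorem laplacian_eq_sum_fderiv (u : E3 → ℝ) (x : E3) :
    Laplacian.laplacian u x = ∑ i : Fin 3, fderiv ℝ (fderiv ℝ u) x
      (EuclideanSpace.basisFun (Fin 3) ℝ i) (EuclideanSpace.basisFun (Fin 3) ℝ i) := by
  rw [InnerProductSpace.laplacian_eq_iteratedFDeriv_orthonormalBasis u
    (EuclideanSpace.basisFun (Fin 3) ℝ)]
  simp [iteratedFDeriv_two_apply]

theorem integral_eq_integral_sphere_Ioi {g : E3 → ℝ} (hg : Integrable g) :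
    ∫ x, g x = ∫ w, (∫ r in Ioi (0 : ℝ), r ^ 2 * g (r • (w : E3))) ∂(volume : Measure E3).toSphere := by
  have hmp := (volume : Measure E3).measurePreserving_homeomorphUnitSphereProd
  have hemb := (homeomorphUnitSphereProd E3).measurableEmbedding
  set G : Metric.sphere (0 : E3) 1 × Ioi (0 : ℝ) → ℝ := fun p => g (p.2.1 • p.1.1) with hG
  have hcomp : ∀ x : ({0}ᶜ : Set E3), G (homeomorphUnitSphereProd E3 x) = g x := by
    intro x
    have := congrArg Subtype.val ((homeomorphUnitSphereProd E3).symm_apply_apply x)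
    rw [homeomorphUnitSphereProd_symm_apply_coe] at this
    rw [hG]
    exact congrArg g this
  have hdim : Module.finrank ℝ E3 - 1 = 2 := by simp
  have e1 : ∫ x, g x = ∫ p, G p ∂((volume : Measure E3).toSphere.prod (Measure.volumeIoiPow 2)) := by
    rw [← hdim, ← hmp.integral_comp hemb]
    simp_rw [hcomp]
    rw [integral_subtype_comap (measurableSet_singleton _).compl g, restrict_compl_singleton]
  have hi : Integrable G ((volume : Measure E3).toSphere.prod (Measure.volumeIoiPow 2)) := by
    rw [← hdim, ← hmp.integrable_comp_emb hemb]
    have : G ∘ homeomorphUnitSphereProd E3 = g ∘ Subtype.val := funext hcomp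
    rw [this, ← integrableOn_iff_comap_subtypeVal (measurableSet_singleton _).compl]
    exact hg.integrableOn
  rw [e1, integral_prod _ hi]
  refine integral_congr_ae (.of_forall fun w => ?_)
  simp only [hG, Measure.volumeIoiPow, ENNReal.ofReal]
  rw [integral_withDensity_eq_integral_smul
      ((measurable_subtype_coe.pow_const _).real_toNNReal),
    integral_subtype_comap measurableSet_Ioi fun a => Real.toNNReal (a ^ 2) • g (a • (w : E3)),
    setIntegral_congr_fun measurableSet_Ioi fun x hx => ?_]
  rw [NNReal.smul_def, Real.coe_toNNReal _ (pow_nonneg (le_of_lt hx) _), smul_eq_mul]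

theorem toSphere_real_univ : (volume : Measure E3).toSphere.real univ = 4 * Real.pi := by
  rw [Measure.toSphere_real_apply_univ, Measure.real, EuclideanSpace.volume_ball_fin_three]
  simp
  rw [ENNReal.toReal_ofReal (by positivity)]
  ring

/-- The fundamental solution property of the Newton kernel in first order form. -/
theorem integral_softGrad_fderiv {f : E3 → ℝ} (hf : ContDiff ℝ 1 f) (hs : HasCompactSupport f)
    (x : E3) (hint : Integrable fun t => softKernel 0 t ^ 3 * fderiv ℝ f (x - t) t) :
    ∫ t, softKernel 0 t ^ 3 * fderiv ℝ f (x - t) t = 4 * Real.pi * f x := by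
  rw [integral_eq_integral_sphere_Ioi hint]
  -- Along a ray the Jacobian `r²`, the kernel `r⁻³` and the factor `r` from the direction cancel.
  -- What remains is a radial derivative, which integrates to `f x` for every `w`.
  have key : ∀ w : Metric.sphere (0 : E3) 1, ∫ r in Ioi (0 : ℝ),
      r ^ 2 * (softKernel 0 (r • (w : E3)) ^ 3 * fderiv ℝ f (x - r • (w : E3)) (r • (w : E3))) =
      f x := by
    intro w
    have hw : ‖(w : E3)‖ = 1 := by simp
    set h : ℝ → ℝ := fun r => f (x - r • (w : E3)) with hh
    have hd : ∀ r, HasDerivAt h (-(fderiv ℝ f (x - r • (w : E3)) w)) r := by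
      intro r
      have h1 : HasDerivAt (fun r : ℝ => x - r • (w : E3)) (-(w : E3)) r := by
        simpa using ((hasDerivAt_id r).smul_const (w : E3)).const_sub x
      have h2 := ((hf.differentiable one_ne_zero) (x - r • (w : E3))).hasFDerivAt.comp_hasDerivAt r h1
      simpa using! h2
    have hcd : ContDiff ℝ 1 h := hf.comp (by fun_prop)
    have hcs : HasCompactSupport h := by
      obtain ⟨R, hR⟩ := hs.isCompact.isBounded.subset_closedBall (0 : E3)
      refine HasCompactSupport.intro (isCompact_closedBall (0 : ℝ) (R + ‖x‖)) fun r hr => ?_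
      by_contra hne
      apply hr
      have h1 : x - r • (w : E3) ∈ Metric.closedBall (0 : E3) R := hR (subset_tsupport _ hne)
      rw [mem_closedBall_zero_iff] at h1 ⊢
      calc ‖r‖ = ‖r • (w : E3)‖ := by rw [norm_smul, hw, mul_one]
        _ = ‖x - (x - r • (w : E3))‖ := by simp
        _ ≤ ‖x‖ + ‖x - r • (w : E3)‖ := norm_sub_le _ _
        _ ≤ R + ‖x‖ := by linarith
    have hI := hcs.integral_Ioi_deriv_eq hcd 0
    have : ∫ r in Ioi (0 : ℝ), r ^ 2 * (softKernel 0 (r • (w : E3)) ^ 3 *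
        fderiv ℝ f (x - r • (w : E3)) (r • (w : E3))) = ∫ r in Ioi (0 : ℝ), -deriv h r := by
      refine setIntegral_congr_fun measurableSet_Ioi fun r hr => ?_
      have hr : 0 < r := hr
      simp only [(hd r).deriv, softKernel_zero, norm_smul, hw, map_smul, smul_eq_mul,
        Real.norm_of_nonneg hr.le]
      field_simp
    rw [this, integral_neg, hI]
    simp [hh]
  simp_rw [key]
  rw [integral_const, toSphere_real_univ, smul_eq_mul]

theorem softGrad_zero_apply (t v : E3) :
    softGrad 0 t v = -(softKernel 0 t ^ 3 * inner ℝ t v) := by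
  have : (‖t‖ ^ 2 + 0) ^ (-(3 / 2) : ℝ) = softKernel 0 t ^ 3 := by
    have h : 0 ≤ ‖t‖ ^ 2 + 0 := by positivity
    rw [softKernel, ← Real.rpow_mul_natCast h]
    norm_num
  rw [softGrad, this]
  simp

/-- The Laplacian of the Newton potential. -/
theorem laplacian_newton {f : E3 → ℝ} (hf : ContDiff ℝ 2 f) (hs : HasCompactSupport f) (x : E3) :
    Laplacian.laplacian (newton f) x = -(4 * Real.pi * f x) := by
  have hf1 : ContDiff ℝ 1 f := hf.of_le (by norm_num)
  have hd : Continuous (fderiv ℝ f) := hf.continuous_fderiv (by norm_num)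
  have c := convolutionExists_softGrad (δ := 0) le_rfl hd (hs.fderiv ℝ) x
  have hc := c.integrable
  set b := EuclideanSpace.basisFun (Fin 3) ℝ with hb
  -- One derivative falls on the kernel and the other on `f`, so the non-integrable second
  -- derivatives of the kernel never appear.
  have hterm : ∀ i, gradConv 0 (fderiv ℝ f) x (b i) (b i) =
      ∫ t, softGrad 0 t (b i) * fderiv ℝ f (x - t) (b i) := by
    intro i
    rw [gradConv, convolution_def, ContinuousLinearMap.integral_apply hc,
      ContinuousLinearMap.integral_apply (hc.apply_continuousLinearMap _)]
    simp
  have hti : ∀ i, Integrable fun t => softGrad 0 t (b i) * fderiv ℝ f (x - t) (b i) := by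
    intro i
    have := (hc.apply_continuousLinearMap (b i)).apply_continuousLinearMap (b i)
    simpa using this
  have hsum : ∀ t : E3, ∑ i, softGrad 0 t (b i) * fderiv ℝ f (x - t) (b i) =
      -(softKernel 0 t ^ 3 * fderiv ℝ f (x - t) t) := by
    intro t
    have ht : fderiv ℝ f (x - t) t = ∑ i, inner ℝ t (b i) * fderiv ℝ f (x - t) (b i) := by
      rw [← congrArg (fderiv ℝ f (x - t)) (b.sum_repr' t), map_sum]
      simp [real_inner_comm]
    rw [ht, Finset.mul_sum, ← Finset.sum_neg_distrib]
    refine Finset.sum_congr rfl fun i _ => ?_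
    rw [softGrad_zero_apply]; ring
  have hint : Integrable fun t => softKernel 0 t ^ 3 * fderiv ℝ f (x - t) t := by
    have := (integrable_finsetSum Finset.univ fun i _ => hti i).neg
    refine this.congr (.of_forall fun t => ?_)
    simp [hsum]
  rw [laplacian_eq_sum_fderiv, fderiv_newton hf1 hs,
    (hasFDerivAt_newton hd (hs.fderiv ℝ) x).fderiv]
  simp_rw [← hb, hterm]
  rw [← integral_finsetSum _ fun i _ => hti i]
  simp_rw [hsum]
  rw [integral_neg, integral_softGrad_fderiv hf1 hs x hint]

/-! ### Sign, monotonicity and decay of Newton potentials. -/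

theorem newton_apply (f : E3 → ℝ) (x : E3) : newton f x = ∫ y, ‖x - y‖⁻¹ * f y := by
  rw [newton, convolution_lsmul_swap]
  simp [softKernel_zero]

theorem integrable_newton {f : E3 → ℝ} (hf : Continuous f) (hs : HasCompactSupport f) (x : E3) :
    Integrable fun y => ‖x - y‖⁻¹ * f y := by
  have := (hs.convolutionExists_right (ContinuousLinearMap.lsmul ℝ ℝ)
    locallyIntegrable_newtonKernel hf x).integrable_swap
  simpa [softKernel_zero] using this

theorem newton_mono {f g : E3 → ℝ} (hf : Continuous f) (hfs : HasCompactSupport f)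
    (hg : Continuous g) (hgs : HasCompactSupport g) (h : ∀ y, f y ≤ g y) (x : E3) :
    newton f x ≤ newton g x := by
  rw [newton_apply, newton_apply]
  refine integral_mono (integrable_newton hf hfs x) (integrable_newton hg hgs x) fun y => ?_
  have := h y
  dsimp only
  gcongr

theorem newton_const_mul (c : ℝ) (f : E3 → ℝ) (x : E3) :
    newton (fun y => c * f y) x = c * newton f x := by
  rw [newton_apply, newton_apply, ← integral_const_mul]
  congr 1; ext y; ring

theorem newton_nonneg {f : E3 → ℝ} (h : ∀ y, 0 ≤ f y) (x : E3) : 0 ≤ newton f x := by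
  rw [newton_apply]
  exact integral_nonneg fun y => mul_nonneg (by positivity) (h y)

theorem newton_pos {f : E3 → ℝ} (hf : Continuous f) (hs : HasCompactSupport f)
    (h : ∀ y, 0 ≤ f y) {y₀ : E3} (h0 : f y₀ ≠ 0) (x : E3) : 0 < newton f x := by
  rw [newton_apply, integral_pos_iff_support_of_nonneg
    (fun y => mul_nonneg (by positivity) (h y)) (integrable_newton hf hs x)]
  have hopen : IsOpen (Function.support f) := hf.isOpen_support
  have hpos : 0 < volume (Function.support f) := hopen.measure_pos _ ⟨y₀, h0⟩
  -- The point `x` is removed because the kernel takes the value `0⁻¹ = 0` there.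
  have hsub : Function.support f \ {x} ⊆ Function.support fun y => ‖x - y‖⁻¹ * f y := by
    rintro y ⟨hy, hyx⟩
    have : x - y ≠ 0 := sub_ne_zero.2 (Ne.symm hyx)
    simpa [this] using hy
  refine lt_of_lt_of_le ?_ (measure_mono hsub)
  rwa [measure_sdiff_null (measure_singleton x)]

theorem tendsto_newton_cocompact {f : E3 → ℝ} (hf : Continuous f) (hs : HasCompactSupport f) :
    Tendsto (newton f) (cocompact E3) (𝓝 0) := by
  obtain ⟨R, hR⟩ := hs.isCompact.isBounded.subset_closedBall (0 : E3)
  have hn := tendsto_norm_cocompact_atTop (E := E3)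
  have hlim : Tendsto (fun x : E3 => (‖x‖ - R)⁻¹ * ∫ y, ‖f y‖) (cocompact E3) (𝓝 0) := by
    have : Tendsto (fun x : E3 => ‖x‖ - R) (cocompact E3) atTop :=
      tendsto_atTop_add_const_right _ (-R) hn
    simpa using this.inv_tendsto_atTop.mul_const (∫ y, ‖f y‖)
  refine squeeze_zero_norm' ?_ hlim
  filter_upwards [hn.eventually_gt_atTop R] with x hx
  rw [newton_apply, ← integral_const_mul]
  refine norm_integral_le_of_norm_le
    ((Continuous.integrable_of_hasCompactSupport hf.norm hs.norm).const_mul _)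
    (.of_forall fun y => ?_)
  rw [norm_mul, norm_inv, norm_norm]
  by_cases hy : f y = 0
  · simp [hy]
  have h1 : y ∈ Metric.closedBall (0 : E3) R := hR (subset_tsupport _ hy)
  rw [mem_closedBall_zero_iff] at h1
  have h2 : ‖x‖ - R ≤ ‖x - y‖ := by linarith [norm_sub_norm_le x y]
  have h3 : 0 < ‖x‖ - R := by linarith
  gcongr

theorem exists_bound_newton {f : E3 → ℝ} (hf : Continuous f) (hs : HasCompactSupport f) :
    ∃ C, 0 ≤ C ∧ ∀ x, newton f x ≤ C := by
  have hc := continuous_newton hf hs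
  have h1 := (tendsto_newton_cocompact hf hs).eventually_lt_const (zero_lt_one)
  obtain ⟨K, hK, hK'⟩ := mem_cocompact.1 h1
  obtain ⟨C, hC⟩ := hK.exists_bound_of_continuousOn hc.continuousOn
  refine ⟨max C 1, by positivity, fun x => ?_⟩
  by_cases hx : x ∈ K
  · exact (le_abs_self _).trans ((hC x hx).trans (le_max_left _ _))
  · exact (le_of_lt (hK' hx)).trans (le_max_right _ _)

/-! ### The maximum principle. -/

/-- Restrict `v` to a line. A positive second derivative would make the maximum a local minimum too,
so `v` would be constant nearby on the line, with zero second derivative. -/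
theorem fderiv_fderiv_nonpos_of_isLocalMax {v : E3 → ℝ} (hv : ContDiff ℝ 2 v) {x : E3}
    (hx : IsLocalMax v x) (e : E3) : fderiv ℝ (fderiv ℝ v) x e e ≤ 0 := by
  set h : ℝ → ℝ := fun s => v (x + s • e) with hh
  have hl : ∀ s, HasDerivAt (fun s : ℝ => x + s • e) e s := fun s => by
    simpa using ((hasDerivAt_id s).smul_const e).const_add x
  have h1 : deriv h = fun s => fderiv ℝ v (x + s • e) e := by
    ext s
    exact (((hv.differentiable (by norm_num)) _).hasFDerivAt.comp_hasDerivAt s (hl s)).deriv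
  have h2 : deriv (deriv h) 0 = fderiv ℝ (fderiv ℝ v) x e e := by
    rw [h1]
    have hd : Differentiable ℝ (fderiv ℝ v) :=
      (hv.fderiv_right (m := 1) (by norm_num)).differentiable one_ne_zero
    have hA : HasDerivAt (fun s : ℝ => fderiv ℝ v (x + s • e))
        (fderiv ℝ (fderiv ℝ v) (x + (0 : ℝ) • e) e) 0 :=
      (hd _).hasFDerivAt.comp_hasDerivAt (0 : ℝ) (hl 0)
    have hB := (hA.clm_apply (hasDerivAt_const (0 : ℝ) e)).deriv
    rw [hB]
    simp
  have hmax : IsLocalMax h 0 := by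
    have hc : Tendsto (fun s : ℝ => x + s • e) (𝓝 0) (𝓝 x) := by
      simpa using (hl 0).continuousAt.tendsto
    have := hc.eventually hx
    simpa [hh, IsLocalMax, IsMaxFilter] using! this
  by_contra! hpos
  rw [← h2] at hpos
  have hcont : ContinuousAt h 0 :=
    hv.continuous.continuousAt.comp (hl 0).continuousAt
  have hmin := isLocalMin_of_deriv_deriv_pos hpos hmax.deriv_eq_zero hcont
  have heq : h =ᶠ[𝓝 0] fun _ => h 0 := by
    filter_upwards [hmin, hmax] with s h1 h2 using le_antisymm h2 h1
  have : deriv (deriv h) 0 = 0 := by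
    rw [(heq.deriv).deriv_eq]; simp
  linarith

theorem laplacian_norm_sq (x : E3) : Laplacian.laplacian (fun y : E3 => ‖y‖ ^ 2) x = 6 := by
  have h1 : fderiv ℝ (fun y : E3 => ‖y‖ ^ 2) = fun y => ((2 : ℝ) • innerSL ℝ) y := by
    ext1 y
    rw [((hasStrictFDerivAt_norm_sq y).hasFDerivAt).fderiv]
    ext z
    simp [two_mul]
  rw [laplacian_eq_sum_fderiv, h1, ContinuousLinearMap.fderiv]
  have h2 : ∀ i, ((2 : ℝ) • innerSL ℝ) (EuclideanSpace.basisFun (Fin 3) ℝ i)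
      (EuclideanSpace.basisFun (Fin 3) ℝ i) = 2 := fun i => by
    change 2 * inner ℝ (EuclideanSpace.basisFun (Fin 3) ℝ i)
      (EuclideanSpace.basisFun (Fin 3) ℝ i) = (2 : ℝ)
    rw [real_inner_self_eq_norm_sq, OrthonormalBasis.norm_eq_one]
    norm_num
  rw [Finset.sum_congr rfl fun i _ => h2 i]
  norm_num

/-- A weak maximum principle on the whole space. -/
theorem le_zero_of_subharmonic_of_tendsto {u : E3 → ℝ} {l : ℝ} (hu : ContDiff ℝ 2 u) (hl : l ≤ 0)
    (ht : Tendsto u (cocompact E3) (𝓝 l)) (h : ∀ x, 0 < u x → 0 ≤ Laplacian.laplacian u x)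
    (x₀ : E3) : u x₀ ≤ 0 := by
  by_contra! hs
  set s := u x₀
  obtain ⟨K, hK, hK'⟩ := mem_cocompact.1 (ht.eventually_lt_const (show l < s / 2 by linarith))
  obtain ⟨R, hR0, hR⟩ := (hK.insert x₀).isBounded.exists_pos_norm_lt
  have hout : ∀ x : E3, R ≤ ‖x‖ → u x < s / 2 := fun x hx =>
    hK' fun hxK => absurd (hR x (mem_insert_of_mem _ hxK)) (by linarith)
  have hx₀ : ‖x₀‖ < R := hR x₀ (mem_insert _ _)
  -- Adding `ε‖x‖²` raises the Laplacian by `6ε > 0`. As `ε R² = s / 2`, the maximum stays off the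
  -- sphere of radius `R`, where `u < s / 2`, and `u` is still positive at the maximum.
  set ε := s / (2 * R ^ 2) with hε
  have hε0 : 0 < ε := by positivity
  have hεR : ε * R ^ 2 = s / 2 := by rw [hε]; field_simp
  have hq : ContDiff ℝ 2 fun y : E3 => ‖y‖ ^ 2 := contDiff_norm_sq ℝ
  have hqe : ContDiff ℝ 2 (ε • fun y : E3 => ‖y‖ ^ 2) := hq.const_smul ε
  set v : E3 → ℝ := u + ε • fun y : E3 => ‖y‖ ^ 2 with hv
  have hvx : ∀ x, v x = u x + ε * ‖x‖ ^ 2 := fun x => rfl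
  have hvc : ContDiff ℝ 2 v := hu.add hqe
  obtain ⟨x₁, hx₁, hmax⟩ := (isCompact_closedBall (0 : E3) R).exists_isMaxOn
    ⟨x₀, by simpa using hx₀.le⟩ hvc.continuous.continuousOn
  have h01 : v x₀ ≤ v x₁ := hmax (by simpa using hx₀.le)
  have hs1 : s ≤ v x₁ := by
    refine le_trans ?_ h01
    rw [hvx]
    have : 0 ≤ ε * ‖x₀‖ ^ 2 := by positivity
    linarith
  rw [mem_closedBall_zero_iff] at hx₁
  have hb : ε * ‖x₁‖ ^ 2 ≤ s / 2 := by rw [← hεR]; gcongr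
  rw [hvx] at hs1
  have hint : ‖x₁‖ < R := by
    by_contra! hge
    linarith [hout x₁ hge]
  have hloc : IsLocalMax v x₁ := hmax.isLocalMax
    (mem_of_superset (Metric.isOpen_ball.mem_nhds (mem_ball_zero_iff.2 hint))
      Metric.ball_subset_closedBall)
  have hle : Laplacian.laplacian v x₁ ≤ 0 := by
    rw [laplacian_eq_sum_fderiv]
    exact Finset.sum_nonpos fun i _ => fderiv_fderiv_nonpos_of_isLocalMax hvc hloc _
  have hlap : Laplacian.laplacian v x₁ = Laplacian.laplacian u x₁ + ε * 6 := by
    rw [hv, ContDiffAt.laplacian_add hu.contDiffAt hqe.contDiffAt,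
      InnerProductSpace.laplacian_smul ε hq.contDiffAt, laplacian_norm_sq, smul_eq_mul]
  linarith [h x₁ (by linarith)]

theorem contDiff_const_add_mul_newton {n : ℕ} {f : E3 → ℝ} (hf : ContDiff ℝ n f)
    (hs : HasCompactSupport f) (d κ : ℝ) :
    ContDiff ℝ (n + 1 : ℕ) fun x => d + κ * newton f x :=
  contDiff_const.add (contDiff_const.mul (contDiff_newton n hf hs))

theorem laplacian_const_add_mul_newton {f : E3 → ℝ} (hf : ContDiff ℝ 2 f)
    (hs : HasCompactSupport f) (d κ : ℝ) (x : E3) :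
    Laplacian.laplacian (fun x => d + κ * newton f x) x = -(4 * Real.pi * κ * f x) := by
  have h2 : ContDiff ℝ 2 (newton f) := (contDiff_newton 2 hf hs).of_le (by norm_num)
  have e : (fun x => d + κ * newton f x) = (fun _ => d) + κ • newton f := rfl
  have h3 : ContDiff ℝ 2 (κ • newton f) := h2.const_smul κ
  rw [e, ContDiffAt.laplacian_add contDiffAt_const h3.contDiffAt,
    InnerProductSpace.laplacian_smul κ h2.contDiffAt, laplacian_newton hf hs]
  simp [InnerProductSpace.laplacian_const]
  ring

theorem tendsto_const_add_mul_newton {f : E3 → ℝ} (hf : Continuous f)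
    (hs : HasCompactSupport f) (d κ : ℝ) :
    Tendsto (fun x => d + κ * newton f x) (cocompact E3) (𝓝 d) := by
  simpa using ((tendsto_newton_cocompact hf hs).const_mul κ).const_add d

/-- The form of the maximum principle behind all comparisons of integral solutions: the sign of the
source matters only where the function is positive. -/
theorem const_add_mul_newton_nonpos {f : E3 → ℝ} (hf : ContDiff ℝ 2 f)
    (hs : HasCompactSupport f) {d κ : ℝ} (hd : d ≤ 0) (hκ : 0 ≤ κ)
    (h : ∀ x, 0 < d + κ * newton f x → f x ≤ 0) (x : E3) : d + κ * newton f x ≤ 0 := by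
  refine le_zero_of_subharmonic_of_tendsto (l := d)
    ((contDiff_const_add_mul_newton hf hs d κ).of_le (by norm_num)) hd
    (tendsto_const_add_mul_newton hf.continuous hs d κ) (fun y hy => ?_) x
  rw [laplacian_const_add_mul_newton hf hs]
  have := mul_nonneg (mul_nonneg (by positivity : 0 ≤ 4 * Real.pi) hκ) (neg_nonneg.2 (h y hy))
  linarith

theorem newton_sub {f g : E3 → ℝ} (hf : Continuous f) (hfs : HasCompactSupport f)
    (hg : Continuous g) (hgs : HasCompactSupport g) (x : E3) :
    newton (fun y => f y - g y) x = newton f x - newton g x := by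
  rw [newton_apply, newton_apply, newton_apply,
    ← integral_sub (integrable_newton hf hfs x) (integrable_newton hg hgs x)]
  congr 1; ext y; ring

/-! ### The integral equation and its equivalence with the boundary value problem. -/

namespace MatterDistribution

variable (ω : MatterDistribution)

/-- The right-hand side `φ θ ^ (-α)` of the equation. -/
noncomputable def source (α : ℝ) (θ : E3 → ℝ) (y : E3) : ℝ := ω.density y * θ y ^ (-α)

variable {ω} {α : ℝ} {θ : E3 → ℝ}

theorem contDiff_density (n : ℕ) : ContDiff ℝ n ω.density :=
  ω.smooth.of_le (by exact_mod_cast le_top)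

theorem contDiff_source {n : ℕ} (hθ : ContDiff ℝ n θ) (hp : ∀ x, 0 < θ x) :
    ContDiff ℝ n (ω.source α θ) :=
  (ω.contDiff_density n).mul (hθ.rpow_const_of_ne fun x => (hp x).ne')

theorem continuous_source (hθ : Continuous θ) (hp : ∀ x, 0 < θ x) :
    Continuous (ω.source α θ) :=
  ω.smooth.continuous.mul (hθ.rpow_const fun x => Or.inl (hp x).ne')

theorem hasCompactSupport_source : HasCompactSupport (ω.source α θ) :=
  ω.hasCompactSupport.mul_right

theorem source_nonneg (hp : ∀ x, 0 < θ x) (x : E3) : 0 ≤ ω.source α θ x :=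
  mul_nonneg (ω.nonneg x) (Real.rpow_nonneg (hp x).le _)

/-- The integral formulation of the generalized Poisson equation. -/
structure IsIntegralSolution (ω : MatterDistribution) (κ α a : ℝ) (θ : E3 → ℝ) : Prop where
  continuous : Continuous θ
  pos : ∀ x, 0 < θ x
  eq : ∀ x, θ x = a + κ * newton (ω.source α θ) x

namespace IsIntegralSolution

variable {κ a : ℝ}

/-- Bootstrap: the source is as smooth as `θ`, and its Newton potential is one derivative smoother.
-/
theorem contDiff (h : ω.IsIntegralSolution κ α a θ) (n : ℕ) : ContDiff ℝ n θ := by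
  induction n with
  | zero => exact_mod_cast contDiff_zero.2 h.continuous
  | succ n ih =>
    have := contDiff_const_add_mul_newton (contDiff_source (ω := ω) (α := α) ih h.pos)
      hasCompactSupport_source a κ
    rwa [← funext h.eq] at this

theorem contDiff_source (h : ω.IsIntegralSolution κ α a θ) : ContDiff ℝ 2 (ω.source α θ) :=
  MatterDistribution.contDiff_source (h.contDiff 2) h.pos

theorem continuous_source (h : ω.IsIntegralSolution κ α a θ) : Continuous (ω.source α θ) :=
  h.contDiff_source.continuous

end IsIntegralSolution

end MatterDistribution

open MatterDistribution

/-- Given a classical solution, `θ - a - κ N(φ θ^(-α))` is harmonic and tends to `0`; the maximum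
principle applied to it and to its negative shows that it vanishes. The converse uses the bootstrap.
-/
theorem isPotential_iff {G c α a : ℝ} {ω : MatterDistribution} {θ : E3 → ℝ} :
    IsPotential G c α a ω θ ↔ ω.IsIntegralSolution (coupling G c) α a θ := by
  have key : ∀ {t : ℝ}, 0 < t → ∀ b d : ℝ, t ^ α * b = -(4 * Real.pi * coupling G c * d) ↔
      b = -(4 * Real.pi * coupling G c * (d * t ^ (-α))) := by
    intro t ht b d
    have h1 : t ^ α * t ^ (-α) = 1 := by rw [← Real.rpow_add ht]; simp
    constructor
    · intro h
      calc b = (t ^ α * t ^ (-α)) * b := by rw [h1, one_mul]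
        _ = t ^ (-α) * (t ^ α * b) := by ring
        _ = _ := by rw [h]; ring
    · rintro rfl
      calc _ = -(4 * Real.pi * coupling G c * d * (t ^ α * t ^ (-α))) := by ring
        _ = _ := by rw [h1, mul_one]
  constructor
  · intro h
    refine ⟨h.contDiff.continuous, h.pos, fun x => ?_⟩
    have hf : ContDiff ℝ 2 (ω.source α θ) := contDiff_source h.contDiff h.pos
    have hs : HasCompactSupport (ω.source α θ) := hasCompactSupport_source
    set v : E3 → ℝ := fun x => a + coupling G c * newton (ω.source α θ) x with hv
    have hvc : ContDiff ℝ 2 v := (contDiff_const_add_mul_newton hf hs _ _).of_le (by norm_num)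
    have hvt : Tendsto v (cocompact E3) (𝓝 a) := tendsto_const_add_mul_newton hf.continuous hs _ _
    have hlap : ∀ y, Laplacian.laplacian v y = Laplacian.laplacian θ y := fun y => by
      rw [laplacian_const_add_mul_newton hf hs, (key (h.pos y) _ _).1 (h.equation y)]
      rfl
    have h1 := le_zero_of_subharmonic_of_tendsto (h.contDiff.sub hvc) le_rfl
      (by simpa using h.boundary.sub hvt) (fun y _ => by
        change 0 ≤ Laplacian.laplacian (θ - v) y
        rw [ContDiffAt.laplacian_sub h.contDiff.contDiffAt hvc.contDiffAt, hlap, sub_self]) x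
    have h2 := le_zero_of_subharmonic_of_tendsto (hvc.sub h.contDiff) le_rfl
      (by simpa using hvt.sub h.boundary) (fun y _ => by
        change 0 ≤ Laplacian.laplacian (v - θ) y
        rw [ContDiffAt.laplacian_sub hvc.contDiffAt h.contDiff.contDiffAt, hlap, sub_self]) x
    change θ x = v x
    exact le_antisymm (sub_nonpos.1 h1) (sub_nonpos.1 h2)
  · intro h
    have hs : HasCompactSupport (ω.source α θ) := hasCompactSupport_source
    refine ⟨h.contDiff 2, h.pos, fun x => (key (h.pos x) _ _).2 ?_, ?_⟩
    · conv_lhs => rw [funext h.eq]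
      rw [laplacian_const_add_mul_newton h.contDiff_source hs]
      rfl
    · rw [funext h.eq]
      exact tendsto_const_add_mul_newton h.continuous_source hs _ _

/-! ### Comparison and a priori bounds. -/

/-- The tangent line inequality for `exp`, applied to `t^(-α) = exp(-α log t)`. -/
theorem rpow_neg_le_rpow_neg_add {t Λ α β : ℝ} (ht : 0 < t) (hΛ : |Real.log t| ≤ Λ)
    (hα : α ∈ Icc (0 : ℝ) 1) :
    t ^ (-α) ≤ t ^ (-β) + Real.exp Λ * Λ * |α - β| := by
  have hΛ0 : 0 ≤ Λ := (abs_nonneg _).trans hΛ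
  rw [Real.rpow_def_of_pos ht, Real.rpow_def_of_pos ht]
  set x := Real.log t * -α
  set y := Real.log t * -β
  have h1 : Real.exp y = Real.exp x * Real.exp (y - x) := by rw [← Real.exp_add]; ring_nf
  have h2 := Real.add_one_le_exp (y - x)
  have h3 : Real.exp x ≤ Real.exp Λ := by
    refine Real.exp_le_exp.2 ((le_abs_self _).trans ?_)
    rw [abs_mul, abs_neg, abs_of_nonneg hα.1]
    nlinarith [abs_nonneg (Real.log t), hα.1, hα.2]
  have h4 : |x - y| ≤ Λ * |α - β| := by
    have : x - y = Real.log t * (β - α) := by ring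
    rw [this, abs_mul, abs_sub_comm β α]
    gcongr
  have h5 : Real.exp x - Real.exp y ≤ Real.exp x * (x - y) := by
    rw [h1]; nlinarith [Real.exp_pos x]
  have h6 : Real.exp x * (x - y) ≤ Real.exp Λ * (Λ * |α - β|) := by
    refine (mul_le_mul_of_nonneg_left (le_abs_self _) (Real.exp_pos x).le).trans ?_
    gcongr
  linarith

namespace MatterDistribution

variable {ω : MatterDistribution} {κ : ℝ}

theorem exists_density_ne_zero (hω : 0 < ω.mass) : ∃ y, ω.density y ≠ 0 := by
  by_contra! h
  simp [mass, h] at hω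

theorem newton_density_pos (hω : 0 < ω.mass) (x : E3) : 0 < newton ω.density x :=
  let ⟨_, hy⟩ := exists_density_ne_zero hω
  newton_pos ω.smooth.continuous ω.hasCompactSupport ω.nonneg hy x

theorem exists_newton_density_ge (hω : 0 < ω.mass) :
    ∃ b > 0, ∀ x, ω.density x ≠ 0 → b ≤ newton ω.density x := by
  obtain ⟨y, hy⟩ := exists_density_ne_zero hω
  obtain ⟨x₀, -, hx₀⟩ := ω.hasCompactSupport.isCompact.exists_isMinOn ⟨y, subset_tsupport _ hy⟩
    (continuous_newton ω.smooth.continuous ω.hasCompactSupport).continuousOn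
  exact ⟨_, newton_density_pos hω x₀, fun x hx => hx₀ (subset_tsupport _ hx)⟩

/-- Comparison of two solutions. -/
theorem IsIntegralSolution.le_add {α₁ α₂ a₁ a₂ b s : ℝ} {θ₁ θ₂ : E3 → ℝ}
    (h₁ : ω.IsIntegralSolution κ α₁ a₁ θ₁) (h₂ : ω.IsIntegralSolution κ α₂ a₂ θ₂)
    (hκ : 0 ≤ κ) (hα₂ : 0 ≤ α₂) (hb : 0 ≤ b) (hs : 0 ≤ s) (hab : a₁ ≤ a₂ + b)
    (h : ∀ x, ω.density x ≠ 0 → θ₁ x ^ (-α₁) ≤ θ₁ x ^ (-α₂) + s) (x : E3) :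
    θ₁ x ≤ θ₂ x + b + κ * s * newton ω.density x := by
  have c1 := h₁.contDiff_source
  have c2 := h₂.contDiff_source
  have s1 : HasCompactSupport (ω.source α₁ θ₁) := hasCompactSupport_source
  have s2 : HasCompactSupport (ω.source α₂ θ₂) := hasCompactSupport_source
  have c3 : ContDiff ℝ 2 fun y => s * ω.density y := contDiff_const.mul (ω.contDiff_density 2)
  have s3 : HasCompactSupport fun y => s * ω.density y := ω.hasCompactSupport.mul_left
  have heq : ∀ y, (a₁ - a₂ - b) +
      κ * newton (fun y => ω.source α₁ θ₁ y - ω.source α₂ θ₂ y - s * ω.density y) y =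
      θ₁ y - θ₂ y - b - κ * s * newton ω.density y := by
    intro y
    rw [newton_sub (f := fun y => ω.source α₁ θ₁ y - ω.source α₂ θ₂ y)
      (c1.sub c2).continuous (s1.sub s2) c3.continuous s3,
      newton_sub c1.continuous s1 c2.continuous s2, newton_const_mul, h₁.eq y, h₂.eq y]
    ring
  have := const_add_mul_newton_nonpos (d := a₁ - a₂ - b) (κ := κ) ((c1.sub c2).sub c3)
    ((s1.sub s2).sub s3) (by linarith) hκ (fun y hy => ?_) x
  · have e := heq x
    linarith
  · have e := heq y
    rw [e] at hy
    by_cases hφ : ω.density y = 0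
    · simp [source, hφ]
    -- At `y` one has `θ₁ > θ₂`, so the decreasing power `t^(-α₂)` bounds the difference of the
    -- sources by `s φ`.
    have hN : 0 ≤ κ * s * newton ω.density y :=
      mul_nonneg (mul_nonneg hκ hs) (newton_nonneg ω.nonneg y)
    have hle : θ₁ y ^ (-α₂) ≤ θ₂ y ^ (-α₂) :=
      Real.rpow_le_rpow_of_nonpos (h₂.pos y) (by linarith) (by linarith)
    have hA : θ₁ y ^ (-α₁) - θ₂ y ^ (-α₂) - s ≤ 0 := by linarith [h y hφ]
    have := mul_nonpos_of_nonneg_of_nonpos (ω.nonneg y) hA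
    simp only [source]
    linarith

theorem IsIntegralSolution.unique {α a : ℝ} {θ₁ θ₂ : E3 → ℝ} (hκ : 0 ≤ κ) (hα : 0 ≤ α)
    (h₁ : ω.IsIntegralSolution κ α a θ₁) (h₂ : ω.IsIntegralSolution κ α a θ₂) : θ₁ = θ₂ := by
  ext x
  have e1 := h₁.le_add h₂ hκ hα le_rfl le_rfl (by simp) (by simp) x
  have e2 := h₂.le_add h₁ hκ hα le_rfl le_rfl (by simp) (by simp) x
  simp only [mul_zero, zero_mul, add_zero] at e1 e2
  exact le_antisymm e1 e2

/-- A small multiple of `N φ` is a subsolution. With `ε N φ ≤ 1`, wherever it exceeds `θ` one has `θ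
≤ 1`, hence `θ^(-α) ≥ 1 ≥ ε / κ`. The bound does not degenerate as `a → 0`. -/
theorem exists_le_of_isIntegralSolution (ω : MatterDistribution) (hκ : 0 < κ) :
    ∃ ε > 0, ∀ α a θ, 0 ≤ α → 0 ≤ a → ω.IsIntegralSolution κ α a θ →
      ∀ x, ε * newton ω.density x ≤ θ x := by
  have cφ := ω.contDiff_density 2
  have sφ := ω.hasCompactSupport
  obtain ⟨C, hC0, hC⟩ := exists_bound_newton cφ.continuous sφ
  refine ⟨min κ (C + 1)⁻¹, by positivity, fun α a θ hα ha h x => ?_⟩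
  set ε := min κ (C + 1)⁻¹ with hε
  have hε0 : 0 < ε := by positivity
  have c1 := h.contDiff_source
  have s1 : HasCompactSupport (ω.source α θ) := hasCompactSupport_source
  have c2 : ContDiff ℝ 2 fun y => ε / κ * ω.density y := contDiff_const.mul cφ
  have s2 : HasCompactSupport fun y => ε / κ * ω.density y := sφ.mul_left
  have heq : ∀ y, -a + κ * newton (fun y => ε / κ * ω.density y - ω.source α θ y) y =
      ε * newton ω.density y - θ y := by
    intro y
    rw [newton_sub c2.continuous s2 c1.continuous s1, newton_const_mul, h.eq y]
    field_simp
    ring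
  have := const_add_mul_newton_nonpos (d := -a) (c2.sub c1) (s2.sub s1) (by linarith) hκ.le
    (fun y hy => ?_) x
  · have e := heq x
    linarith
  · have e := heq y
    rw [e] at hy
    have h1 : ε * newton ω.density y ≤ 1 := by
      calc ε * newton ω.density y ≤ (C + 1)⁻¹ * (C + 1) := by
            gcongr
            · exact newton_nonneg ω.nonneg y
            · exact min_le_right _ _
            · linarith [hC y]
        _ = 1 := by field_simp
    have h2 : 1 ≤ θ y ^ (-α) :=
      Real.one_le_rpow_of_pos_of_le_one_of_nonpos (h.pos y) (by linarith) (by linarith)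
    have h3 : ε / κ ≤ 1 := (div_le_one hκ).2 (min_le_left _ _)
    have := mul_nonpos_of_nonneg_of_nonpos (ω.nonneg y)
      (by linarith : ε / κ - θ y ^ (-α) ≤ 0)
    simp only [source]
    linarith

/-- `a + A N φ` is a supersolution once `A N φ ≥ 1` where `φ ≠ 0`: wherever `θ` exceeds it there,
`θ^(-α) ≤ 1 ≤ A / κ`. -/
theorem exists_ge_of_isIntegralSolution (hω : 0 < ω.mass) (hκ : 0 < κ) :
    ∃ C ≥ 0, ∀ α a θ, 0 ≤ α → 0 ≤ a → ω.IsIntegralSolution κ α a θ → ∀ x, θ x ≤ C + a := by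
  have cφ := ω.contDiff_density 2
  have sφ := ω.hasCompactSupport
  obtain ⟨C, hC0, hC⟩ := exists_bound_newton cφ.continuous sφ
  obtain ⟨b, hb, hbN⟩ := exists_newton_density_ge hω
  set A := max κ b⁻¹ with hA
  have hA0 : 0 < A := lt_max_of_lt_left hκ
  refine ⟨A * C, by positivity, fun α a θ hα ha h x => ?_⟩
  have c1 := h.contDiff_source
  have s1 : HasCompactSupport (ω.source α θ) := hasCompactSupport_source
  have c2 : ContDiff ℝ 2 fun y => A / κ * ω.density y := contDiff_const.mul cφ
  have s2 : HasCompactSupport fun y => A / κ * ω.density y := sφ.mul_left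
  have heq : ∀ y, 0 + κ * newton (fun y => ω.source α θ y - A / κ * ω.density y) y =
      θ y - a - A * newton ω.density y := by
    intro y
    rw [newton_sub c1.continuous s1 c2.continuous s2, newton_const_mul, h.eq y]
    field_simp
    ring
  have := const_add_mul_newton_nonpos (d := 0) (c1.sub c2) (s1.sub s2) le_rfl hκ.le
    (fun y hy => ?_) x
  · have e := heq x
    have := mul_le_mul_of_nonneg_left (hC x) hA0.le
    linarith
  · have e := heq y
    rw [e] at hy
    by_cases hφ : ω.density y = 0
    · simp [source, hφ]
    have h1 : 1 ≤ A * newton ω.density y := by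
      calc 1 = b⁻¹ * b := by field_simp
        _ ≤ A * newton ω.density y := by
          gcongr
          · exact le_max_right _ _
          · exact hbN y hφ
    have h2 : θ y ^ (-α) ≤ 1 := Real.rpow_le_one_of_one_le_of_nonpos (by linarith) (by linarith)
    have h3 : 1 ≤ A / κ := (one_le_div hκ).2 (le_max_left _ _)
    have := mul_nonpos_of_nonneg_of_nonpos (ω.nonneg y)
      (by linarith : θ y ^ (-α) - A / κ ≤ 0)
    simp only [source]
    linarith

/-- Solutions depend in a Lipschitz way on the boundary value and on the exponent. -/
theorem exists_lipschitz_isIntegralSolution (hω : 0 < ω.mass) (hκ : 0 < κ) (a₀ : ℝ) :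
    ∃ L ≥ 0, ∀ α₁ ∈ Icc (0 : ℝ) 1, ∀ α₂ ∈ Icc (0 : ℝ) 1, ∀ a₁ ∈ Icc 0 a₀, ∀ a₂ ∈ Icc 0 a₀,
      ∀ θ₁ θ₂, ω.IsIntegralSolution κ α₁ a₁ θ₁ → ω.IsIntegralSolution κ α₂ a₂ θ₂ →
      ∀ x, |θ₁ x - θ₂ x| ≤ |a₁ - a₂| + L * |α₁ - α₂| := by
  obtain ⟨ε, hε, hlow⟩ := exists_le_of_isIntegralSolution ω hκ
  obtain ⟨M, hM, hup⟩ := exists_ge_of_isIntegralSolution hω hκ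
  obtain ⟨b, hb, hbN⟩ := exists_newton_density_ge hω
  obtain ⟨C, hC0, hC⟩ := exists_bound_newton ω.smooth.continuous ω.hasCompactSupport
  -- This bounds `|log θ|` where `φ ≠ 0`, by `ε b ≤ θ ≤ M + a₀`, for all admissible `α` and `a` at
  -- once.
  set Λ := max |Real.log (ε * b)| |Real.log (M + a₀)| with hΛ
  have hΛ0 : 0 ≤ Λ := (abs_nonneg _).trans (le_max_left _ _)
  have main : ∀ α₁ ∈ Icc (0 : ℝ) 1, ∀ α₂ ∈ Icc (0 : ℝ) 1, ∀ a₁ ∈ Icc 0 a₀, ∀ a₂ ∈ Icc 0 a₀,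
      ∀ θ₁ θ₂, ω.IsIntegralSolution κ α₁ a₁ θ₁ → ω.IsIntegralSolution κ α₂ a₂ θ₂ →
      ∀ x, θ₁ x ≤ θ₂ x + |a₁ - a₂| + κ * (Real.exp Λ * Λ * |α₁ - α₂|) * C := by
    intro α₁ hα₁ α₂ hα₂ a₁ ha₁ a₂ ha₂ θ₁ θ₂ h₁ h₂ x
    refine (h₁.le_add h₂ hκ.le hα₂.1 (abs_nonneg (a₁ - a₂))
      (s := Real.exp Λ * Λ * |α₁ - α₂|) (by positivity)
      (by linarith [le_abs_self (a₁ - a₂)]) (fun y hy => ?_) x).trans ?_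
    · refine rpow_neg_le_rpow_neg_add (h₁.pos y) ?_ hα₁
      have l1 : ε * b ≤ θ₁ y := (mul_le_mul_of_nonneg_left (hbN y hy) hε.le).trans
        (hlow α₁ a₁ θ₁ hα₁.1 ha₁.1 h₁ y)
      have l2 : θ₁ y ≤ M + a₀ := (hup α₁ a₁ θ₁ hα₁.1 ha₁.1 h₁ y).trans (by linarith [ha₁.2])
      have l3 := Real.log_le_log (by positivity) l1
      have l4 := Real.log_le_log (h₁.pos y) l2
      refine abs_le.2 ⟨?_, l4.trans ((le_abs_self _).trans (le_max_right _ _))⟩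
      have := (neg_abs_le (Real.log (ε * b)))
      linarith [le_max_left |Real.log (ε * b)| |Real.log (M + a₀)|]
    · have := hC x
      gcongr
  refine ⟨κ * (Real.exp Λ * Λ) * C, by positivity, ?_⟩
  intro α₁ hα₁ α₂ hα₂ a₁ ha₁ a₂ ha₂ θ₁ θ₂ h₁ h₂ x
  have e1 := main α₁ hα₁ α₂ hα₂ a₁ ha₁ a₂ ha₂ θ₁ θ₂ h₁ h₂ x
  have e2 := main α₂ hα₂ α₁ hα₁ a₂ ha₂ a₁ ha₁ θ₂ θ₁ h₂ h₁ x
  rw [abs_sub_comm a₂, abs_sub_comm α₂] at e2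
  rw [abs_le]
  constructor <;> nlinarith

end MatterDistribution

/-! ### Existence. -/

namespace MatterDistribution

variable {ω : MatterDistribution} {κ : ℝ}

/-- In the logarithmic variable a shift by `s` costs a factor `exp(α s)`, which the linear operator
`N` preserves and `log` turns into `α s`. -/
theorem source_exp_le {α s : ℝ} (hα : 0 ≤ α) {u v : E3 → ℝ} (h : ∀ x, |u x - v x| ≤ s) (y : E3) :
    ω.source α (fun x => Real.exp (u x)) y ≤
      Real.exp (α * s) * ω.source α (fun x => Real.exp (v x)) y := by
  unfold source
  rw [← Real.exp_mul, ← Real.exp_mul]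
  have h1 : Real.exp (u y * -α) ≤ Real.exp (α * s) * Real.exp (v y * -α) := by
    rw [← Real.exp_add]
    refine Real.exp_le_exp.2 ?_
    have := mul_le_mul_of_nonneg_left ((neg_le_abs _).trans (h y)) hα
    linarith
  have := mul_le_mul_of_nonneg_left h1 (ω.nonneg y)
  linarith

open scoped BoundedContinuousFunction in
-- The map `u ↦ log(a + κ N(φ e^(-αu)))` contracts the bounded continuous functions with constant
-- `α`; `a > 0` keeps the logarithm bounded.
theorem exists_isIntegralSolution_of_lt (ω : MatterDistribution) (hκ : 0 ≤ κ) {α a : ℝ}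
    (hα : 0 ≤ α) (hα1 : α < 1) (ha : 0 < a) : ∃ θ, ω.IsIntegralSolution κ α a θ := by
  have hsrc : ∀ u : E3 →ᵇ ℝ, Continuous (ω.source α fun x => Real.exp (u x)) := fun u =>
    continuous_source (Real.continuous_exp.comp u.continuous) fun x => Real.exp_pos _
  have hcs : ∀ u : E3 →ᵇ ℝ, HasCompactSupport (ω.source α fun x => Real.exp (u x)) := fun u =>
    hasCompactSupport_source
  set P : (E3 →ᵇ ℝ) → E3 → ℝ := fun u x =>
    a + κ * newton (ω.source α fun x => Real.exp (u x)) x with hP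
  have hPa : ∀ u x, a ≤ P u x := fun u x => by
    have := mul_nonneg hκ (newton_nonneg
      (source_nonneg (ω := ω) (α := α) fun x => Real.exp_pos (u x)) x)
    simp only [hP]
    linarith
  have hP0 : ∀ u x, 0 < P u x := fun u x => ha.trans_le (hPa u x)
  have hPc : ∀ u, Continuous (P u) := fun u =>
    continuous_const.add (continuous_const.mul (continuous_newton (hsrc u) (hcs u)))
  have hb : ∀ u, ∃ C, ∀ x, ‖Real.log (P u x)‖ ≤ C := by
    intro u
    obtain ⟨C, hC0, hC⟩ := exists_bound_newton (hsrc u) (hcs u)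
    refine ⟨max |Real.log a| |Real.log (a + κ * C)|, fun x => ?_⟩
    have h1 := Real.log_le_log ha (hPa u x)
    have h2 : Real.log (P u x) ≤ Real.log (a + κ * C) := Real.log_le_log (hP0 u x)
      (add_le_add le_rfl (mul_le_mul_of_nonneg_left (hC x) hκ))
    rw [Real.norm_eq_abs, abs_le]
    constructor
    · linarith [neg_abs_le (Real.log a), le_max_left |Real.log a| |Real.log (a + κ * C)|]
    · exact h2.trans ((le_abs_self _).trans (le_max_right _ _))
  choose C hC using hb
  set T : (E3 →ᵇ ℝ) → (E3 →ᵇ ℝ) := fun u => BoundedContinuousFunction.ofNormedAddCommGroup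
    (fun x => Real.log (P u x)) ((hPc u).log fun x => (hP0 u x).ne') (C u) (hC u) with hT
  have hle : ∀ u v x, Real.log (P u x) ≤ α * dist u v + Real.log (P v x) := by
    intro u v x
    have hs : 0 ≤ α * dist u v := mul_nonneg hα dist_nonneg
    rw [← Real.log_exp (α * dist u v), ← Real.log_mul (Real.exp_pos _).ne' (hP0 v x).ne']
    refine Real.log_le_log (hP0 u x) ?_
    have h1 := newton_mono (hsrc u) (hcs u)
      (g := fun y => Real.exp (α * dist u v) * ω.source α (fun x => Real.exp (v x)) y)
      (continuous_const.mul (hsrc v)) (hcs v).mul_left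
      (source_exp_le (ω := ω) hα fun x => u.dist_coe_le_dist (g := v) x) x
    rw [newton_const_mul] at h1
    have h2 := mul_le_mul_of_nonneg_left h1 hκ
    -- The constant `a` is absorbed by the same factor `exp(α s) ≥ 1`.
    have h3 := mul_le_mul_of_nonneg_right (Real.one_le_exp hs) ha.le
    simp only [hP]
    linarith
  have hcontr : ContractingWith α.toNNReal T := by
    refine ⟨by simpa using hα1, LipschitzWith.of_dist_le_mul fun u v => ?_⟩
    rw [Real.coe_toNNReal α hα, BoundedContinuousFunction.dist_le (mul_nonneg hα dist_nonneg)]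
    intro x
    change |Real.log (P u x) - Real.log (P v x)| ≤ _
    have h1 := hle u v x
    have h2 := hle v u x
    rw [dist_comm v u] at h2
    rw [abs_le]
    constructor <;> linarith
  set u := ContractingWith.fixedPoint T hcontr
  have hu : T u = u := hcontr.fixedPoint_isFixedPt
  refine ⟨fun x => Real.exp (u x), Real.continuous_exp.comp u.continuous,
    fun x => Real.exp_pos _, fun x => ?_⟩
  have : u x = Real.log (P u x) := (DFunLike.congr_fun hu x).symm
  rw [this, Real.exp_log (hP0 u x)]

/-- Where `φ ≠ 0`, `θ` is bounded below uniformly, and `α ≤ 1` then bounds `θ^(-α)`. This is the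
dominating function for the limits of sources. -/
theorem exists_source_le (hω : 0 < ω.mass) (hκ : 0 < κ) :
    ∃ B ≥ 0, ∀ α ∈ Icc (0 : ℝ) 1, ∀ a ≥ 0, ∀ θ, ω.IsIntegralSolution κ α a θ →
      ∀ x, ω.source α θ x ≤ B * ω.density x := by
  obtain ⟨ε, hε, hlow⟩ := exists_le_of_isIntegralSolution ω hκ
  obtain ⟨b, hb, hbN⟩ := exists_newton_density_ge hω
  refine ⟨max 1 (ε * b)⁻¹, by positivity, fun α hα a ha θ h x => ?_⟩
  by_cases hφ : ω.density x = 0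
  · simp [source, hφ]
  have hl : ε * b ≤ θ x := (mul_le_mul_of_nonneg_left (hbN x hφ) hε.le).trans
    (hlow α a θ hα.1 ha h x)
  rw [source, mul_comm]
  refine mul_le_mul_of_nonneg_right ?_ (ω.nonneg x)
  rcases le_total 1 (θ x) with h1 | h1
  · exact (Real.rpow_le_one_of_one_le_of_nonpos h1 (by linarith [hα.1])).trans (le_max_left _ _)
  · refine le_trans ?_ (le_max_right _ _)
    calc θ x ^ (-α) ≤ θ x ^ (-1 : ℝ) :=
          Real.rpow_le_rpow_of_exponent_ge (h.pos x) h1 (by linarith [hα.2])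
      _ = (θ x)⁻¹ := Real.rpow_neg_one _
      _ ≤ (ε * b)⁻¹ := by gcongr

/-- With `g` the Newton kernel this passes to the limit in the equation; with `g = 1` it gives
convergence of the effective mass. -/
theorem tendsto_integral_mul_source (hω : 0 < ω.mass) (hκ : 0 < κ) {ι : Type*} {l : Filter ι}
    [l.IsCountablyGenerated] {α : ι → ℝ} {a : ι → ℝ} {θ : ι → E3 → ℝ} {α' : ℝ} {θ' : E3 → ℝ}
    (hα : ∀ i, α i ∈ Icc (0 : ℝ) 1) (ha : ∀ i, 0 ≤ a i)
    (hθ : ∀ i, ω.IsIntegralSolution κ (α i) (a i) (θ i)) (hlα : Tendsto α l (𝓝 α'))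
    (hlθ : ∀ x, Tendsto (fun i => θ i x) l (𝓝 (θ' x))) (hθ' : ∀ x, 0 < θ' x) {g : E3 → ℝ}
    (hgm : AEStronglyMeasurable g) (hg : Integrable fun y => g y * ω.density y) :
    Tendsto (fun i => ∫ y, g y * ω.source (α i) (θ i) y) l
      (𝓝 (∫ y, g y * ω.source α' θ' y)) := by
  obtain ⟨B, hB, hle⟩ := exists_source_le hω hκ
  refine tendsto_integral_filter_of_dominated_convergence
    (fun y => B * ‖g y * ω.density y‖) (.of_forall fun i => ?_) (.of_forall fun i =>
      .of_forall fun y => ?_) (hg.norm.const_mul B) (.of_forall fun y => ?_)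
  · exact hgm.mul (hθ i).continuous_source.aestronglyMeasurable
  · have h1 := hle (α i) (hα i) (a i) (ha i) (θ i) (hθ i) y
    rw [norm_mul, norm_mul, Real.norm_of_nonneg (source_nonneg (hθ i).pos y),
      Real.norm_of_nonneg (ω.nonneg y)]
    have := mul_le_mul_of_nonneg_left h1 (norm_nonneg (g y))
    linarith
  · exact (((hlθ y).rpow hlα.neg (Or.inl (hθ' y).ne')).const_mul _).const_mul _

theorem exists_isIntegralSolution (hω : 0 < ω.mass) (hκ : 0 < κ) {α a : ℝ}
    (hα : α ∈ Icc (0 : ℝ) 1) (ha : 0 ≤ a) : ∃ θ, ω.IsIntegralSolution κ α a θ := by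
  set t : ℕ → ℝ := fun n => 1 / ((n : ℝ) + 1) with ht
  have ht0 : ∀ n, 0 < t n := fun n => by positivity
  have ht1 : ∀ n, t n ≤ 1 := fun n => by
    simp only [ht]
    rw [div_le_one (by positivity)]
    linarith [(Nat.cast_nonneg n : (0 : ℝ) ≤ n)]
  have htl : Tendsto t atTop (𝓝 0) := tendsto_one_div_add_atTop_nhds_zero_nat
  -- The perturbed data satisfy `A n > 0` and `β n < 1`, the range of the contraction argument; the
  -- Lipschitz estimate makes their solutions uniformly Cauchy.
  set A : ℕ → ℝ := fun n => a + t n with hA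
  set β : ℕ → ℝ := fun n => α * (1 - t n) with hβ
  have hAl : Tendsto A atTop (𝓝 a) := by simpa using htl.const_add a
  have hβl : Tendsto β atTop (𝓝 α) := by simpa using (htl.const_sub 1).const_mul α
  have hβm : ∀ n, β n ∈ Icc (0 : ℝ) 1 ∧ β n < 1 := fun n => by
    have h1 := ht0 n
    have h2 := ht1 n
    have h3 := hα.1
    have h4 := hα.2
    have h5 : β n ≤ 1 - t n := mul_le_of_le_one_left (by linarith) h4
    exact ⟨⟨mul_nonneg h3 (by linarith), by linarith⟩, by linarith⟩
  have hAm : ∀ n, A n ∈ Icc 0 (a + 1) := fun n =>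
    ⟨by have := ht0 n; simp only [hA]; linarith, by have := ht1 n; simp only [hA]; linarith⟩
  have hex : ∀ n, ∃ θ, ω.IsIntegralSolution κ (β n) (A n) θ := fun n =>
    exists_isIntegralSolution_of_lt ω hκ.le (hβm n).1.1 (hβm n).2
      (by have := ht0 n; simp only [hA]; linarith)
  choose θ hθ using hex
  obtain ⟨L, hL, hlip⟩ := exists_lipschitz_isIntegralSolution hω hκ (a + 1)
  have hd : ∀ n m x, dist (θ n x) (θ m x) ≤ dist (A n) (A m) + L * dist (β n) (β m) :=
    fun n m x => hlip _ (hβm n).1 _ (hβm m).1 _ (hAm n) _ (hAm m) _ _ (hθ n) (hθ m) x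
  have hcau : ∀ x, CauchySeq fun n => θ n x := by
    intro x
    rw [cauchySeq_iff_tendsto_dist_atTop_0]
    have h1 := cauchySeq_iff_tendsto_dist_atTop_0.1 hAl.cauchySeq
    have h2 := cauchySeq_iff_tendsto_dist_atTop_0.1 hβl.cauchySeq
    refine squeeze_zero (fun _ => dist_nonneg) (fun p => hd p.1 p.2 x) ?_
    simpa using h1.add (h2.const_mul L)
  choose θ' hθ' using fun x => cauchySeq_tendsto_of_complete (hcau x)
  have hunif : TendstoUniformly θ θ' atTop := by
    rw [Metric.tendstoUniformly_iff]
    intro ε hε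
    have h0 : Tendsto (fun n => dist (A n) a + L * dist (β n) α) atTop (𝓝 0) := by
      simpa using (tendsto_iff_dist_tendsto_zero.1 hAl).add
        ((tendsto_iff_dist_tendsto_zero.1 hβl).const_mul L)
    filter_upwards [h0.eventually_lt_const hε] with n hn x
    refine lt_of_le_of_lt ?_ hn
    rw [dist_comm]
    exact le_of_tendsto_of_tendsto (tendsto_const_nhds.dist (hθ' x))
      ((tendsto_const_nhds.dist hAl).add ((tendsto_const_nhds.dist hβl).const_mul L))
      (.of_forall fun m => hd n m x)
  obtain ⟨ε, hε, hlow⟩ := exists_le_of_isIntegralSolution ω hκ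
  -- The lower bound `ε N φ` is uniform in `n`, so positivity survives even for `a = 0`.
  have hpos : ∀ x, 0 < θ' x := fun x =>
    (mul_pos hε (newton_density_pos hω x)).trans_le (ge_of_tendsto' (hθ' x) fun n =>
      hlow _ _ _ (hβm n).1.1 (hAm n).1 (hθ n) x)
  refine ⟨θ', hunif.continuous (.of_forall fun n => (hθ n).continuous), hpos, fun x => ?_⟩
  have hN := tendsto_integral_mul_source hω hκ (fun n => (hβm n).1) (fun n => (hAm n).1) hθ hβl
    hθ' hpos (g := fun y => ‖x - y‖⁻¹)
    (by fun_prop : Measurable fun y : E3 => ‖x - y‖⁻¹).aestronglyMeasurable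
    (integrable_newton ω.smooth.continuous ω.hasCompactSupport x)
  simp_rw [← newton_apply] at hN
  refine tendsto_nhds_unique (hθ' x) ((hAl.add (hN.const_mul κ)).congr fun n => ?_)
  exact ((hθ n).eq x).symm

theorem existsUnique_isIntegralSolution (hω : 0 < ω.mass) (hκ : 0 < κ) {α a : ℝ}
    (hα : α ∈ Icc (0 : ℝ) 1) (ha : 0 ≤ a) : ∃! θ, ω.IsIntegralSolution κ α a θ := by
  obtain ⟨θ, hθ⟩ := exists_isIntegralSolution hω hκ hα ha
  exact ⟨θ, hθ, fun θ' hθ' => hθ'.unique hκ.le hα.1 hθ⟩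

/-! ### Scaling covariance. -/

/-- The factor `t^α` in the density cancels `t^(-α)` from `(tθ)^(-α)`, leaving the Jacobian `t³`. -/
theorem source_scale {ω' : MatterDistribution} {α t : ℝ} {θ : E3 → ℝ} (hp : ∀ x, 0 < θ x)
    (ht : 0 < t) (hω' : ∀ x, ω'.density x = t ^ (3 + α) * ω.density (t • x)) (y : E3) :
    ω'.source α (fun x => t * θ (t • x)) y = t ^ 3 * ω.source α θ (t • y) := by
  have : t ^ (3 + α) * t ^ (-α) = t ^ 3 := by
    rw [← Real.rpow_add ht, add_neg_cancel_right, ← Real.rpow_natCast]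
    norm_num
  rw [source, source, hω', Real.mul_rpow ht.le (hp _).le, ← this]
  ring

/-- The scaling covariance of the equation. -/
theorem IsIntegralSolution.scale {ω' : MatterDistribution} {α a t : ℝ} {θ : E3 → ℝ}
    (h : ω.IsIntegralSolution κ α a θ) (ht : 0 < t)
    (hω' : ∀ x, ω'.density x = t ^ (3 + α) * ω.density (t • x)) :
    ω'.IsIntegralSolution κ α (t * a) fun x => t * θ (t • x) := by
  refine ⟨continuous_const.mul (h.continuous.comp (continuous_const_smul t)),
    fun x => mul_pos ht (h.pos _), fun x => ?_⟩
  have hsrc := source_scale h.pos ht hω'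
  have hN : newton (ω'.source α fun x => t * θ (t • x)) x = t * newton (ω.source α θ) (t • x) := by
    rw [newton_apply, newton_apply]
    simp_rw [hsrc]
    have e := Measure.integral_comp_smul volume
      (fun y : E3 => ‖t • x - y‖⁻¹ * ω.source α θ y) t
    have hdim : Module.finrank ℝ E3 = 3 := by simp
    rw [hdim, abs_of_nonneg (by positivity), smul_eq_mul, eq_comm, inv_mul_eq_iff_eq_mul₀
      (by positivity)] at e
    rw [e, ← mul_assoc, ← integral_const_mul]
    congr 1
    ext y
    rw [← smul_sub, norm_smul, Real.norm_of_nonneg ht.le]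
    field_simp
  rw [hN, h.eq]
  ring

end MatterDistribution

/-! ### Potentials of shrinking sources. -/

section ApproximateIdentity

variable {f : ℕ → E3 → ℝ} {ρ : ℕ → ℝ} {M : ℝ}

theorem tendstoUniformly_convolution_of_shrinking {F : Type} [NormedAddCommGroup F]
    [NormedSpace ℝ F] [CompleteSpace F] {g : E3 → F} (hg : Continuous g)
    (hgs : HasCompactSupport g) (hf : ∀ n, Integrable (f n)) (hf0 : ∀ n x, 0 ≤ f n x)
    (hfs : ∀ n, Function.support (f n) ⊆ Metric.ball 0 (ρ n)) (hρ : Tendsto ρ atTop (𝓝 0))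
    (hM : Tendsto (fun n => ∫ x, f n x) atTop (𝓝 M)) :
    TendstoUniformly (fun n => convolution (f n) g (ContinuousLinearMap.lsmul ℝ ℝ) volume)
      (fun x => M • g x) atTop := by
  obtain ⟨C, hC⟩ := hgs.exists_bound_of_continuous hg
  have hC0 : 0 ≤ C := (norm_nonneg _).trans (hC 0)
  have huc := Metric.uniformContinuous_iff.1 (hgs.uniformContinuous_of_continuous hg)
  rw [Metric.tendstoUniformly_iff]
  intro ε hε
  have hM0 : 0 ≤ M := ge_of_tendsto' hM fun n => integral_nonneg (hf0 n)
  obtain ⟨δ, hδ, hgδ⟩ := huc (ε / (2 * (M + 1))) (by positivity)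
  have h1 : Tendsto (fun n => |(∫ x, f n x) - M| * C) atTop (𝓝 0) := by
    simpa using ((hM.sub_const M).abs).mul_const C
  filter_upwards [hρ.eventually_lt_const hδ, hM.eventually_lt_const (lt_add_one M),
    h1.eventually_lt_const (half_pos hε)] with n hn1 hn2 hn3 x
  have hd : dist (convolution (f n) g (ContinuousLinearMap.lsmul ℝ ℝ) volume x)
      (∫ t, (ContinuousLinearMap.lsmul ℝ ℝ) (f n t) (g x)) ≤
      (‖(ContinuousLinearMap.lsmul ℝ ℝ : ℝ →L[ℝ] F →L[ℝ] F)‖ * ∫ t, ‖f n t‖) *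
        (ε / (2 * (M + 1))) :=
    dist_convolution_le' _ (by positivity) (hf n) (hfs n) hg.aestronglyMeasurable fun y hy =>
      (hgδ ((Metric.mem_ball.1 hy).trans hn1)).le
  have e1 : ∫ t, (ContinuousLinearMap.lsmul ℝ ℝ) (f n t) (g x) = (∫ t, f n t) • g x := by
    simp only [ContinuousLinearMap.lsmul_apply]
    exact integral_smul_const _ _
  have e2 : ∫ t, ‖f n t‖ = ∫ t, f n t :=
    integral_congr_ae (.of_forall fun t => Real.norm_of_nonneg (hf0 n t))
  have hI : 0 ≤ ∫ t, f n t := integral_nonneg (hf0 n)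
  rw [e1, e2] at hd
  have hd' : (‖(ContinuousLinearMap.lsmul ℝ ℝ : ℝ →L[ℝ] F →L[ℝ] F)‖ * ∫ t, f n t) *
      (ε / (2 * (M + 1))) ≤ ε / 2 := by
    calc _ ≤ (1 * (M + 1)) * (ε / (2 * (M + 1))) := by
          gcongr
          exact ContinuousLinearMap.opNorm_lsmul_le
      _ = ε / 2 := by field_simp
  have hd2 : dist ((∫ t, f n t) • g x) (M • g x) ≤ |(∫ x, f n x) - M| * C := by
    rw [dist_eq_norm, ← sub_smul, norm_smul, Real.norm_eq_abs]
    have := hC x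
    gcongr
  rw [dist_comm]
  linarith [dist_triangle (convolution (f n) g (ContinuousLinearMap.lsmul ℝ ℝ) volume x)
    ((∫ t, f n t) • g x) (M • g x)]

/-- All derivatives fall on `g`, so each order reduces to the undifferentiated statement for a
vector-valued `g`. -/
theorem tendstoUniformly_iteratedFDeriv_convolution_of_shrinking
    (hf : ∀ n, Integrable (f n)) (hf0 : ∀ n x, 0 ≤ f n x)
    (hfs : ∀ n, Function.support (f n) ⊆ Metric.ball 0 (ρ n)) (hρ : Tendsto ρ atTop (𝓝 0))
    (hM : Tendsto (fun n => ∫ x, f n x) atTop (𝓝 M)) (k : ℕ) :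
    ∀ {F : Type} [NormedAddCommGroup F] [NormedSpace ℝ F] [CompleteSpace F] {g : E3 → F},
    ContDiff ℝ k g → HasCompactSupport g →
    TendstoUniformly (fun n => iteratedFDeriv ℝ k
        (convolution (f n) g (ContinuousLinearMap.lsmul ℝ ℝ) volume))
      (fun x => M • iteratedFDeriv ℝ k g x) atTop := by
  induction k with
  | zero =>
    intro F _ _ _ g hg hgs
    have := tendstoUniformly_convolution_of_shrinking hg.continuous hgs hf hf0 hfs hρ hM
    rw [Metric.tendstoUniformly_iff] at this ⊢
    intro ε hε
    filter_upwards [this ε hε] with n hn x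
    rw [iteratedFDeriv_zero_eq_comp, iteratedFDeriv_zero_eq_comp, Function.comp_apply,
      Function.comp_apply, ← LinearIsometryEquiv.map_smul, LinearIsometryEquiv.dist_map]
    exact hn x
  | succ k ih =>
    intro F _ _ _ g hg hgs
    have hg1 : ContDiff ℝ 1 g := hg.of_le (by exact_mod_cast Nat.succ_le_succ (Nat.zero_le k))
    rw [Nat.cast_add, Nat.cast_one] at hg
    have := ih (contDiff_succ_iff_fderiv.1 hg).2.2 (hgs.fderiv ℝ)
    have hd : ∀ n, fderiv ℝ (convolution (f n) g (ContinuousLinearMap.lsmul ℝ ℝ) volume) =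
        convolution (f n) (fderiv ℝ g) (ContinuousLinearMap.lsmul ℝ ℝ) volume := by
      intro n
      ext1 x
      rw [(hgs.hasFDerivAt_convolution_right (ContinuousLinearMap.lsmul ℝ ℝ)
        (hf n).locallyIntegrable hg1 x).fderiv, convolution_def, convolution_def]
      congr
    rw [Metric.tendstoUniformly_iff] at this ⊢
    intro ε hε
    filter_upwards [this ε hε] with n hn x
    rw [iteratedFDeriv_succ_eq_comp_right, iteratedFDeriv_succ_eq_comp_right,
      Function.comp_apply, Function.comp_apply, ← LinearIsometryEquiv.map_smul,
      LinearIsometryEquiv.dist_map, hd]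
    exact hn x

end ApproximateIdentity

/-- A smooth compactly supported function that agrees with `|x|⁻¹` on an annulus. -/
theorem exists_contDiff_eq_inv_norm {r R : ℝ} (hr : 0 < r) (hR : 0 < R) :
    ∃ g : E3 → ℝ, (∀ k : ℕ, ContDiff ℝ k g) ∧ HasCompactSupport g ∧
      ∀ x, r ≤ ‖x‖ → ‖x‖ ≤ R → g x = ‖x‖⁻¹ := by
  -- `1 - χ₀` removes the singularity at the origin, and `χ₁` makes the support compact.
  let χ₀ : ContDiffBump (0 : E3) := ⟨r / 2, r, by positivity, by linarith⟩
  let χ₁ : ContDiffBump (0 : E3) := ⟨R, R + 1, hR, by linarith⟩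
  refine ⟨fun x => χ₁ x * ((1 - χ₀ x) * ‖x‖⁻¹), fun k => ?_, χ₁.hasCompactSupport.mul_right,
    fun x h1 h2 => ?_⟩
  · rw [contDiff_iff_contDiffAt]
    intro x
    rcases eq_or_ne x 0 with rfl | hx
    · have : (fun x => χ₁ x * ((1 - χ₀ x) * ‖x‖⁻¹)) =ᶠ[𝓝 0] fun _ => (0 : ℝ) := by
        filter_upwards [χ₀.eventuallyEq_one] with y hy
        simp [hy]
      exact contDiffAt_const.congr_of_eventuallyEq this
    · exact χ₁.contDiff.contDiffAt.mul ((contDiffAt_const.sub χ₀.contDiff.contDiffAt).mul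
        ((contDiffAt_norm ℝ hx).inv (norm_ne_zero_iff.2 hx)))
  · have e1 : χ₁ x = 1 := χ₁.one_of_mem_closedBall (by simpa using h2)
    have e0 : χ₀ x = 0 := χ₀.zero_of_le_dist (by simpa using h1)
    simp [e1, e0]

theorem newton_eq_convolution {f g : E3 → ℝ} {x : E3}
    (h : ∀ t, f t ≠ 0 → g (x - t) = ‖x - t‖⁻¹) :
    newton f x = convolution f g (ContinuousLinearMap.lsmul ℝ ℝ) volume x := by
  rw [newton_apply, convolution_lsmul]
  congr 1
  ext t
  by_cases ht : f t = 0
  · simp [ht]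
  · rw [h t ht, smul_eq_mul, mul_comm]

theorem iteratedFDeriv_const_add_smul {k : ℕ} {g : E3 → ℝ} (hg : ContDiff ℝ k g) (b s : ℝ)
    (x : E3) : iteratedFDeriv ℝ k ((fun _ => b) + s • g) x =
      iteratedFDeriv ℝ k (fun _ : E3 => b) x + s • iteratedFDeriv ℝ k g x := by
  have h : ContDiff ℝ k (s • g) := hg.const_smul s
  rw [iteratedFDeriv_add_apply contDiffAt_const h.contDiffAt,
    iteratedFDeriv_const_smul_apply hg.contDiffAt]

/-- Newton potentials of sources that shrink to the origin converge, with all derivatives, to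
the potential of a point mass. -/
theorem tendstoUniformlyOn_iteratedFDeriv_newton {f : ℕ → E3 → ℝ} {ρ : ℕ → ℝ} {M : ℝ}
    (hf : ∀ n, Continuous (f n)) (hfc : ∀ n, HasCompactSupport (f n)) (hf0 : ∀ n x, 0 ≤ f n x)
    (hfs : ∀ n, Function.support (f n) ⊆ Metric.ball 0 (ρ n)) (hρ : Tendsto ρ atTop (𝓝 0))
    (hM : Tendsto (fun n => ∫ x, f n x) atTop (𝓝 M)) (b κ : ℝ) {K : Set E3} (hK : IsCompact K)
    (hK0 : K ⊆ {0}ᶜ) (k : ℕ) :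
    TendstoUniformlyOn (fun n => iteratedFDeriv ℝ k fun x => b + κ * newton (f n) x)
      (iteratedFDeriv ℝ k fun x => b + κ * M / ‖x‖) atTop K := by
  obtain ⟨R, hR0, hR⟩ := hK.isBounded.exists_pos_norm_lt
  obtain ⟨r, hr0, hr⟩ : ∃ r > 0, ∀ x ∈ K, r < ‖x‖ := by
    rcases K.eq_empty_or_nonempty with rfl | hne
    · exact ⟨1, one_pos, by simp⟩
    · obtain ⟨x₀, hx₀, hmin⟩ := hK.exists_isMinOn hne continuous_norm.continuousOn
      have : 0 < ‖x₀‖ := norm_pos_iff.2 (hK0 hx₀)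
      exact ⟨‖x₀‖ / 2, by positivity, fun x hx => by
        have h : ‖x₀‖ ≤ ‖x‖ := hmin hx
        linarith⟩
  -- For `r < ‖x‖ < R` and `‖t‖ < r / 2` one has `r / 2 ≤ ‖x - t‖ ≤ R + r`, where `g` equals the
  -- kernel.
  obtain ⟨g, hg, hgs, hgeq⟩ := exists_contDiff_eq_inv_norm (half_pos hr0)
    (show 0 < R + r by positivity)
  have hfi : ∀ n, Integrable (f n) := fun n => (hf n).integrable_of_hasCompactSupport (hfc n)
  have hlim := tendstoUniformly_iteratedFDeriv_convolution_of_shrinking hfi hf0 hfs hρ hM k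
    (hg k) hgs
  set U : Set E3 := {x | r < ‖x‖ ∧ ‖x‖ < R} with hU
  have hUo : IsOpen U :=
    (isOpen_lt continuous_const continuous_norm).inter (isOpen_lt continuous_norm continuous_const)
  have hpt : ∀ x ∈ U, iteratedFDeriv ℝ k (fun x => b + κ * M / ‖x‖) x =
      iteratedFDeriv ℝ k (fun _ => b) x + (κ * M) • iteratedFDeriv ℝ k g x := by
    intro x hx
    have he : (fun x => b + κ * M / ‖x‖) =ᶠ[𝓝 x] (fun _ => b) + (κ * M) • g := by
      filter_upwards [hUo.mem_nhds hx] with y hy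
      simp only [Pi.add_apply, Pi.smul_apply, smul_eq_mul]
      rw [hgeq y (by linarith [hy.1]) (by linarith [hy.2]), div_eq_mul_inv]
    rw [(Filter.EventuallyEq.iteratedFDeriv ℝ he k).eq_of_nhds, iteratedFDeriv_const_add_smul (hg k)]
  have hn : ∀ n, ρ n < r / 2 → ∀ x ∈ U,
      iteratedFDeriv ℝ k (fun x => b + κ * newton (f n) x) x =
      iteratedFDeriv ℝ k (fun _ => b) x + κ • iteratedFDeriv ℝ k
        (convolution (f n) g (ContinuousLinearMap.lsmul ℝ ℝ) volume) x := by
    intro n hρn x hx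
    have hc : ContDiff ℝ k (convolution (f n) g (ContinuousLinearMap.lsmul ℝ ℝ) volume) :=
      hgs.contDiff_convolution_right (n := k) _ (hfi n).locallyIntegrable (hg k)
    have he : (fun x => b + κ * newton (f n) x) =ᶠ[𝓝 x] (fun _ => b) +
        κ • convolution (f n) g (ContinuousLinearMap.lsmul ℝ ℝ) volume := by
      filter_upwards [hUo.mem_nhds hx] with y hy
      simp only [Pi.add_apply, Pi.smul_apply, smul_eq_mul]
      rw [newton_eq_convolution fun t ht => ?_]
      have h1 : ‖t‖ < ρ n := mem_ball_zero_iff.1 (hfs n ht)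
      exact hgeq _ (by linarith [norm_sub_norm_le y t, hy.1]) (by linarith [norm_sub_le y t, hy.2])
    rw [(Filter.EventuallyEq.iteratedFDeriv ℝ he k).eq_of_nhds, iteratedFDeriv_const_add_smul hc]
  rw [Metric.tendstoUniformly_iff] at hlim
  rw [Metric.tendstoUniformlyOn_iff]
  intro ε hε
  filter_upwards [hlim (ε / (|κ| + 1)) (by positivity),
    hρ.eventually_lt_const (half_pos hr0)] with n h1 h2 x hx
  have hxU : x ∈ U := ⟨hr x hx, hR x hx⟩
  rw [hpt x hxU, hn n h2 x hxU, dist_add_left, mul_smul, dist_smul₀, Real.norm_eq_abs]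
  calc |κ| * _ ≤ |κ| * (ε / (|κ| + 1)) := by
        gcongr
        exact (h1 x).le
    _ < ε := by
        rw [mul_div_assoc', div_lt_iff₀ (by positivity)]
        linarith

/-! ### From measures to densities. -/

namespace MatterDistribution

/-- The density of a rescaled push-forward. -/
theorem density_eq_of_toMeasure_eq {ω Ω : MatterDistribution} {d α : ℝ} (hd : 0 < d)
    (h : ω.toMeasure = ENNReal.ofReal (d ^ (-α)) •
      Measure.map (fun x : E3 => d • x) Ω.toMeasure) (x : E3) :
    Ω.density x = d ^ (3 + α) * ω.density (d • x) := by
  set ψ : E3 → ℝ := fun x => d ^ (-(3 + α)) * Ω.density (d⁻¹ • x) with hψ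
  have hψc : Continuous ψ :=
    continuous_const.mul (Ω.smooth.continuous.comp (continuous_const_smul _))
  have hdim : Module.finrank ℝ E3 = 3 := by simp
  have hm : Measurable fun x : E3 => d • x := measurable_const_smul d
  have heq : ω.toMeasure = volume.withDensity fun x => ENNReal.ofReal (ψ x) := by
    rw [h]
    ext s hs
    have hΩm : Measurable fun x => ENNReal.ofReal (Ω.density (d⁻¹ • x)) :=
      (Ω.smooth.continuous.comp (continuous_const_smul _)).measurable.ennreal_ofReal
    have e1 : (fun x => ENNReal.ofReal (ψ x)) = fun x =>
        ENNReal.ofReal (d ^ (-(3 + α))) * ENNReal.ofReal (Ω.density (d⁻¹ • x)) := by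
      ext x
      exact ENNReal.ofReal_mul (by positivity)
    have e2 : ∫⁻ x in (fun x : E3 => d • x) ⁻¹' s, ENNReal.ofReal (Ω.density x) =
        ∫⁻ x in s, ENNReal.ofReal (Ω.density (d⁻¹ • x))
          ∂(Measure.map (fun x : E3 => d • x) volume) := by
      rw [setLIntegral_map hs hΩm hm]
      simp [smul_smul, hd.ne']
    have e3 : ENNReal.ofReal (d ^ (-(3 + α))) =
        ENNReal.ofReal (d ^ (-α)) * ENNReal.ofReal |(d ^ 3)⁻¹| := by
      rw [← ENNReal.ofReal_mul (by positivity), abs_of_nonneg (by positivity),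
        ← Real.rpow_natCast, ← Real.rpow_neg hd.le, ← Real.rpow_add hd]
      congr 2
      norm_num
    rw [Measure.smul_apply, Measure.map_apply hm hs, toMeasure,
      withDensity_apply _ (hm hs), withDensity_apply _ hs, e1, e2,
      Measure.map_addHaar_smul _ hd.ne', hdim, Measure.restrict_smul, lintegral_smul_measure,
      lintegral_const_mul _ hΩm, e3, smul_eq_mul, smul_eq_mul, mul_assoc]
  have hae : (fun x => ENNReal.ofReal (ω.density x)) =ᵐ[volume] fun x => ENNReal.ofReal (ψ x) :=
    (withDensity_eq_iff_of_sigmaFinite ω.smooth.continuous.measurable.ennreal_ofReal.aemeasurable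
      hψc.measurable.ennreal_ofReal.aemeasurable).1 heq
  have hae' : ω.density =ᵐ[volume] ψ := by
    filter_upwards [hae] with x hx
    have hx0 : 0 ≤ ψ x := mul_nonneg (by positivity) (Ω.nonneg _)
    exact (ENNReal.ofReal_eq_ofReal_iff (ω.nonneg x) hx0).1 hx
  -- Equality of measures gives the densities only almost everywhere; continuity makes it pointwise.
  have hall : ω.density = ψ := (Continuous.ae_eq_iff_eq volume ω.smooth.continuous hψc).1 hae'
  rw [hall, hψ]
  simp only
  rw [smul_smul, inv_mul_cancel₀ hd.ne', one_smul, ← mul_assoc, ← Real.rpow_add hd]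
  simp

end MatterDistribution

open MatterDistribution

/-! ### The effective mass and its continuity. -/

section Potential

variable {G c α a : ℝ} {ω : MatterDistribution}

theorem existsUnique_isPotential (hκ : 0 < coupling G c) (hω : 0 < ω.mass)
    (hα : α ∈ Icc (0 : ℝ) 1) (ha : 0 ≤ a) : ∃! θ, IsPotential G c α a ω θ := by
  simp_rw [isPotential_iff]
  exact existsUnique_isIntegralSolution hω hκ hα ha

theorem isIntegralSolution_potential (h : ∃ θ, IsPotential G c α a ω θ) :
    ω.IsIntegralSolution (coupling G c) α a (potential G c α a ω) :=
  isPotential_iff.1 (Classical.epsilon_spec h)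

theorem effectiveMass_eq (h : ∃ θ, IsPotential G c α 0 ω θ) :
    effectiveMass G c ω α = ∫ y, ω.source α (potential G c α 0 ω) y := by
  refine integral_congr_ae (.of_forall fun y => ?_)
  simp only [source]
  rw [Real.rpow_neg ((isIntegralSolution_potential h).pos y).le, div_eq_mul_inv]

theorem continuousOn_effectiveMass (hκ : 0 < coupling G c) (hω : 0 < ω.mass) :
    ContinuousOn (effectiveMass G c ω) (Icc 0 1) := by
  have hsol : ∀ α : Icc (0 : ℝ) 1, ω.IsIntegralSolution (coupling G c) α 0
      (potential G c α 0 ω) := fun α =>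
    isIntegralSolution_potential (existsUnique_isPotential hκ hω α.2 le_rfl).exists
  obtain ⟨L, hL, hlip⟩ := exists_lipschitz_isIntegralSolution hω hκ 0
  rw [continuousOn_iff_continuous_domRestrict, continuous_iff_continuousAt]
  intro β
  have hlim : Tendsto (fun α : Icc (0 : ℝ) 1 => (α : ℝ)) (𝓝 β) (𝓝 (β : ℝ)) :=
    continuous_subtype_val.tendsto β
  have hθ : ∀ x, Tendsto (fun α : Icc (0 : ℝ) 1 => potential G c α 0 ω x) (𝓝 β)
      (𝓝 (potential G c β 0 ω x)) := by
    intro x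
    have h0 : Tendsto (fun α : Icc (0 : ℝ) 1 => L * dist (α : ℝ) β) (𝓝 β) (𝓝 0) := by
      simpa using (tendsto_iff_dist_tendsto_zero.1 hlim).const_mul L
    refine tendsto_iff_dist_tendsto_zero.2 (squeeze_zero (fun _ => dist_nonneg) (fun α => ?_) h0)
    simpa using! hlip α α.2 β β.2 0 (by simp) 0 (by simp) _ _ (hsol α) (hsol β) x
  have := tendsto_integral_mul_source hω hκ (fun α : Icc (0 : ℝ) 1 => α.2) (fun _ => le_rfl)
    hsol hlim hθ (hsol β).pos (g := fun _ => 1) aestronglyMeasurable_const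
    (by simpa using ω.smooth.continuous.integrable_of_hasCompactSupport ω.hasCompactSupport)
  simp only [one_mul] at this
  have he : ∀ α : Icc (0 : ℝ) 1, (Icc (0 : ℝ) 1).domRestrict (effectiveMass G c ω) α =
      ∫ y, ω.source α (potential G c α 0 ω) y := fun α =>
    effectiveMass_eq (existsUnique_isPotential hκ hω α.2 le_rfl).exists
  rw [ContinuousAt, he β]
  exact this.congr fun α => (he α).symm

theorem contDiffOn_pointPotential (M : ℝ) :
    ContDiffOn ℝ (⊤ : ℕ∞) (pointPotential G c M) {0}ᶜ := fun _ hx =>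
  (contDiffAt_const.add (contDiffAt_const.div (contDiffAt_norm ℝ hx)
    (norm_ne_zero_iff.2 hx))).contDiffWithinAt

theorem dilationScale_pos (hκ : 0 < coupling G c) (hω : 0 < ω.mass) {r : ℝ} (hr : 0 < r) :
    0 < dilationScale G c ω r := by
  unfold dilationScale; positivity

theorem tendsto_dilationScale {r : ℕ → ℝ} (hr : Tendsto r atTop (𝓝 0)) :
    Tendsto (fun n => dilationScale G c ω (r n)) atTop (𝓝 0) := by
  have : ∀ n, (coupling G c * ω.mass)⁻¹ * r n = dilationScale G c ω (r n) := fun n => by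
    rw [dilationScale, ← mul_div_assoc, inv_div, mul_comm, div_eq_mul_inv]
  simpa using (hr.const_mul (coupling G c * ω.mass)⁻¹).congr this

end Potential

/-! ### Self-similar sequences. -/

section SelfSimilar

variable {G c α : ℝ} {Ω : MatterDistribution} {r : ℕ → ℝ} {ω : ℕ → MatterDistribution}

/-- Rescaling by `d⁻¹` carries the solution for `Ω` with boundary value `d` to one for `ω n` with
boundary value `1`. -/
theorem IsSelfSimilar.existsUnique_isPotential (h : IsSelfSimilar G c α Ω r ω)
    (hκ : 0 < coupling G c) (hΩ : 0 < Ω.mass) (hα : α ∈ Icc (0 : ℝ) 1) (n : ℕ) :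
    ∃! θ, IsPotential G c α 1 (ω n) θ := by
  set d := dilationScale G c Ω (r n)
  have hd : 0 < d := dilationScale_pos hκ hΩ (h.radius_pos n)
  have hden := density_eq_of_toMeasure_eq hd (h.scaling n)
  obtain ⟨η, hη⟩ := exists_isIntegralSolution hΩ hκ hα hd.le
  simp_rw [isPotential_iff]
  have hden' : ∀ x, (ω n).density x = d⁻¹ ^ (3 + α) * Ω.density (d⁻¹ • x) := fun x => by
    rw [hden, ← mul_assoc, ← Real.mul_rpow (by positivity) hd.le, inv_mul_cancel₀ hd.ne',
      smul_smul, mul_inv_cancel₀ hd.ne']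
    simp
  have hθ := hη.scale (inv_pos.2 hd) hden'
  rw [inv_mul_cancel₀ hd.ne'] at hθ
  exact ⟨_, hθ, fun θ hθ' => hθ'.unique hκ.le hα.1 hθ⟩

theorem IsSelfSimilar.convergesWithAllDerivatives (h : IsSelfSimilar G c α Ω r ω)
    (hκ : 0 < coupling G c) (hΩ : 0 < Ω.mass) (hα : α ∈ Icc (0 : ℝ) 1) :
    ConvergesWithAllDerivatives {0}ᶜ (fun n => potential G c α 1 (ω n))
      (pointPotential G c (effectiveMass G c Ω α)) := by
  set θ : ℕ → E3 → ℝ := fun n => potential G c α 1 (ω n)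
  have hθ : ∀ n, (ω n).IsIntegralSolution (coupling G c) α 1 (θ n) := fun n =>
    isIntegralSolution_potential (h.existsUnique_isPotential hκ hΩ hα n).exists
  refine ⟨fun n => (contDiff_infty.2 (hθ n).contDiff).contDiffOn, contDiffOn_pointPotential _,
    fun K hK hK0 k => ?_⟩
  set d : ℕ → ℝ := fun n => dilationScale G c Ω (r n)
  have hd : ∀ n, 0 < d n := fun n => dilationScale_pos hκ hΩ (h.radius_pos n)
  have hdl : Tendsto d atTop (𝓝 0) := tendsto_dilationScale h.radius_tendsto
  have hden : ∀ n x, Ω.density x = d n ^ (3 + α) * (ω n).density (d n • x) := fun n =>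
    density_eq_of_toMeasure_eq (hd n) (h.scaling n)
  set η : ℕ → E3 → ℝ := fun n x => d n * θ n (d n • x)
  have hη : ∀ n, Ω.IsIntegralSolution (coupling G c) α (d n) (η n) := fun n => by
    simpa using (hθ n).scale (hd n) (hden n)
  have hex := (_root_.existsUnique_isPotential hκ hΩ hα le_rfl).exists
  have hΘ := isIntegralSolution_potential hex
  have hηl : ∀ x, Tendsto (fun n => η n x) atTop (𝓝 (potential G c α 0 Ω x)) := by
    intro x
    -- Comparison of the boundary values `0` and `d n` for the same source squeezes `η n` between
    -- `Θ` and `Θ + d n`.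
    refine tendsto_of_tendsto_of_tendsto_of_le_of_le (g := fun _ => potential G c α 0 Ω x)
      (h := fun n => potential G c α 0 Ω x + d n) tendsto_const_nhds
      (by simpa using hdl.const_add (potential G c α 0 Ω x)) (fun n => ?_) (fun n => ?_)
    · simpa using hΘ.le_add (hη n) hκ.le hα.1 le_rfl le_rfl (by simpa using (hd n).le)
        (by simp) x
    · simpa using (hη n).le_add hΘ hκ.le hα.1 (hd n).le le_rfl (by simp) (by simp) x
  set f : ℕ → E3 → ℝ := fun n => (ω n).source α (θ n)
  have hsrc : ∀ n y, Ω.source α (η n) y = d n ^ 3 * f n (d n • y) := fun n =>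
    source_scale (hθ n).pos (hd n) (hden n)
  -- The rescaling preserves the total mass of the source, so the limit can be taken on the fixed
  -- support of `Ω`.
  have hmass : ∀ n, ∫ y, Ω.source α (η n) y = ∫ y, f n y := by
    intro n
    have hdim : Module.finrank ℝ E3 = 3 := by simp
    have h3 : 0 < d n ^ 3 := pow_pos (hd n) 3
    simp_rw [hsrc]
    rw [integral_const_mul, Measure.integral_comp_smul, hdim, abs_of_nonneg (by positivity),
      smul_eq_mul, mul_inv_cancel_left₀ h3.ne']
  have hM : Tendsto (fun n => ∫ y, f n y) atTop (𝓝 (effectiveMass G c Ω α)) := by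
    rw [effectiveMass_eq hex]
    have := tendsto_integral_mul_source hΩ hκ (fun _ => hα) (fun n => (hd n).le) hη
      tendsto_const_nhds hηl hΘ.pos (g := fun _ => 1) aestronglyMeasurable_const
      (by simpa using Ω.smooth.continuous.integrable_of_hasCompactSupport Ω.hasCompactSupport)
    simp only [one_mul] at this
    exact this.congr hmass
  obtain ⟨S, hS0, hS⟩ := Ω.hasCompactSupport.isCompact.isBounded.exists_pos_norm_lt
  have hsupp : ∀ n, Function.support (f n) ⊆ Metric.ball 0 (d n * S) := by
    intro n x hx
    have hne : (ω n).density x ≠ 0 := left_ne_zero_of_mul hx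
    have hx' : Ω.density ((d n)⁻¹ • x) ≠ 0 := by
      rw [hden n, smul_smul, mul_inv_cancel₀ (hd n).ne', one_smul]
      exact mul_ne_zero (Real.rpow_pos_of_pos (hd n) _).ne' hne
    have := hS _ (subset_tsupport _ hx')
    rw [norm_smul, norm_inv, Real.norm_of_nonneg (hd n).le, inv_mul_lt_iff₀ (hd n)] at this
    simpa using this
  have hlim := tendstoUniformlyOn_iteratedFDeriv_newton (fun n => (hθ n).continuous_source)
    (fun n => hasCompactSupport_source) (fun n x => source_nonneg (hθ n).pos x) hsupp
    (by simpa using hdl.mul_const S) hM 1 (coupling G c) hK hK0 k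
  have e1 : ∀ n, (fun x => 1 + coupling G c * newton (f n) x) = θ n := fun n =>
    (funext (hθ n).eq).symm
  exact hlim.congr (.of_forall fun n x _ => congrArg (fun u => iteratedFDeriv ℝ k u x) (e1 n))

end SelfSimilar

theorem theorem3p1 (G c : ℝ) (hG : 0 < G) (hc : 0 < c) (Ω : MatterDistribution)
    (hΩ : 0 < Ω.mass) :
    -- the zero-boundary problem that defines the effective mass is uniquely solvable
    (∀ α ∈ Icc (0 : ℝ) 1, ∃! Θ : E3 → ℝ, IsPotential G c α 0 Ω Θ) ∧
    -- convergence to the point-source potential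
    (∀ α ∈ Icc (0 : ℝ) 1, ∀ (r : ℕ → ℝ) (ω : ℕ → MatterDistribution),
      IsSelfSimilar G c α Ω r ω →
        (∀ n, ∃! θ : E3 → ℝ, IsPotential G c α 1 (ω n) θ) ∧
        ConvergesWithAllDerivatives {0}ᶜ (fun n => potential G c α 1 (ω n))
          (pointPotential G c (effectiveMass G c Ω α))) ∧
    -- continuity of the effective mass in the interactivity
    ContinuousOn (effectiveMass G c Ω) (Icc 0 1) := by
  have hκ : 0 < coupling G c := by unfold coupling; positivity
  exact ⟨fun α hα => existsUnique_isPotential hκ hΩ hα le_rfl,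
    fun α hα r ω h => ⟨h.existsUnique_isPotential hκ hΩ hα,
      h.convergesWithAllDerivatives hκ hΩ hα⟩,
    continuousOn_effectiveMass hκ hΩ⟩
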